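/- **Definitions.** A *conical affine special Kähler manifold* $(M,J,g,\nabla,\xi)$ is a pseudo-Kähler manifold $(M,J,g)$ with a flat torsion-free connection $\nabla$ and a vector field $\xi$ such that $\nabla\omega=0$ for $\omega=g(J\cdot,\cdot)$; $d^\nabla J=0$; $\nabla\xi=D\xi=\mathrm{Id}$, where $D$ is the Levi-Civita connection of $g$; and $g$ is positive definite on $\mathcal D=\mathrm{span}\{\xi,J\xi\}$ and negative definite on $\mathcal D^\perp$. Put $f=g(\xi,\xi)$ and $\alpha=g(\xi,\cdot)$. If $\xi$ and $J\xi$ generate a principal $\mathbb C^*$-action on $M$, with projection $\pi\colon M\to\bar M=M/\mathbb C^*$, then $\bar M$ carries the unique Riemannian (Kähler) metric $\bar g$ with $$\pi^*\bar g=-\frac{g}{f}+\frac{\alpha^2+(J^*\alpha)^2}{f^2},$$ and $(\bar M,\bar g)$ is called a *projective special Kähler manifold*. $(\bar M,\bar g)$ is said to have *regular boundary behaviour* if there are a smooth manifold with boundary $\mathcal M$ and a smooth embedding $i\colon M\to\mathcal M$ with $i(M)=\mathcal M\setminus\partial\mathcal M$ such that 1. $J,g,\xi$ (transported by $i$) extend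 to smooth tensor fields on $\mathcal M$, denoted by the same letters, and $f=g(\xi,\xi)$ on $\mathcal M$; 2. for every $p\in\partial\mathcal M$: $f(p)=0$, $df_p\neq0$, and $g_p$ is negative semidefinite on $\mathcal H_p=T_p\partial\mathcal M\cap J(T_p\partial\mathcal M)$, the kernel of $g_p|_{\mathcal H_p\times\mathcal H_p}$ being $\mathrm{span}\{\xi_p,J\xi_p\}$; 3. $\xi$ and $J\xi$ generate a principal (smooth, free and proper) $\mathbb C^*$-action on $\mathcal M$, extending the one on $M$; 4. the quotient $\mathcal M/\mathbb C^*$ is compact. **Theorem.** Every projective special Kähler manifold $(\bar M,\bar g)$ with regular boundary behaviour is a complete Riemannian manifold. -/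

import Mathlib

open Set Filter Topology Bundle Manifold
open scoped ContDiff

noncomputable section

namespace SpecialKahler

section Tensors

variable {E : Type*} [NormedAddCommGroup E] [NormedSpace ℝ E]
  {H : Type*} [TopologicalSpace H] (I : ModelWithCorners ℝ E H)
  (M : Type*) [TopologicalSpace M] [ChartedSpace H M]

/-- Vector fields on a manifold (no regularity built in). -/
abbrev VField : Type _ := ∀ x : M, TangentSpace I x

/-- Fields of endomorphisms of the tangent spaces (no regularity built in). -/
abbrev EndField : Type _ := ∀ x : M, TangentSpace I x →L[ℝ] TangentSpace I x

/-- Fields of bilinear forms on the tangent spaces (no regularity built in). -/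
abbrev BilinField : Type _ := ∀ x : M, TangentSpace I x →L[ℝ] TangentSpace I x →L[ℝ] ℝ

/-- Connections on the tangent bundle. -/
abbrev Connection [IsManifold I 1 M] : Type _ := CovariantDerivative I E (TangentSpace I : M → Type _)

end Tensors

section Geometry

variable {E : Type*} [NormedAddCommGroup E] [NormedSpace ℝ E]
  {H : Type*} [TopologicalSpace H] {I : ModelWithCorners ℝ E H}
  {M : Type*} [TopologicalSpace M] [ChartedSpace H M]

/-- The vector field `X` is of class `C^∞`. -/
def SmoothVField [IsManifold I 1 M] (X : VField I M) : Prop :=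
  ContMDiff I (I.prod 𝓘(ℝ, E)) ∞ (fun x ↦ TotalSpace.mk' E x (X x))

/-- The endomorphism field `J` is of class `C^∞`. -/
def SmoothEndField [IsManifold I 1 M] (J : EndField I M) : Prop :=
  ContMDiff I (I.prod 𝓘(ℝ, E →L[ℝ] E)) ∞ (fun x ↦ TotalSpace.mk' (E →L[ℝ] E) x (J x))

/-- The field of bilinear forms `g` is of class `C^∞`. -/
def SmoothBilinField [IsManifold I 1 M] (g : BilinField I M) : Prop :=
  ContMDiff I (I.prod 𝓘(ℝ, E →L[ℝ] E →L[ℝ] ℝ)) ∞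
    (fun x ↦ TotalSpace.mk' (E →L[ℝ] E →L[ℝ] ℝ) x (g x))

/-- The vector field `J X`. -/
def appField (J : EndField I M) (X : VField I M) : VField I M := fun x ↦ J x (X x)

/-- The function `b(X, Y)`. -/
def evalField (b : BilinField I M) (X Y : VField I M) : M → ℝ := fun x ↦ b x (X x) (Y x)

/-- The Lie derivative `X φ = dφ(X)` of a function. -/
def lieD (X : VField I M) (φ : M → ℝ) : M → ℝ := fun x ↦ mvfderiv I φ x (X x)

/-- The vector field `∇_X Y`. -/
def covD [IsManifold I 1 M] (nabla : Connection I M) (X Y : VField I M) : VField I M := fun x ↦ nabla Y x (X x)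

/-- The form `ω = g(J ·, ·)`. -/
def kahlerForm (J : EndField I M) (g : BilinField I M) : BilinField I M :=
  fun x ↦ (g x).comp (J x)

/-- The 2-form `b` is closed; `db(X, Y, Z)` is written out by the invariant formula. -/
def IsClosedTwoForm [IsManifold I 1 M] (b : BilinField I M) : Prop :=
  ∀ X Y Z : VField I M, SmoothVField X → SmoothVField Y → SmoothVField Z →
    lieD X (evalField b Y Z) + lieD Y (evalField b Z X) + lieD Z (evalField b X Y)
      - evalField b (VectorField.mlieBracket I X Y) Z
      - evalField b (VectorField.mlieBracket I Y Z) X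
      - evalField b (VectorField.mlieBracket I Z X) Y = 0

/-- `J` is a complex structure: a smooth almost complex structure whose Nijenhuis tensor
vanishes. -/
structure IsComplexStructure [IsManifold I 1 M] (J : EndField I M) : Prop where
  smooth : SmoothEndField J
  sq : ∀ (x : M) (v : TangentSpace I x), J x (J x v) = -v
  nijenhuis : ∀ X Y : VField I M, SmoothVField X → SmoothVField Y →
    VectorField.mlieBracket I (appField J X) (appField J Y)
      - appField J (VectorField.mlieBracket I (appField J X) Y)
      - appField J (VectorField.mlieBracket I X (appField J Y))
      - VectorField.mlieBracket I X Y = 0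

/-- `g` is a pseudo-Riemannian metric. -/
structure IsPseudoRiemannian [IsManifold I 1 M] (g : BilinField I M) : Prop where
  smooth : SmoothBilinField g
  symm : ∀ (x : M) (v w : TangentSpace I x), g x v w = g x w v
  nondegenerate : ∀ (x : M) (v : TangentSpace I x), (∀ w, g x v w = 0) → v = 0

/-- `(M, J, g)` is a pseudo-Kähler manifold. -/
structure IsPseudoKahler [IsManifold I 1 M] (J : EndField I M) (g : BilinField I M) : Prop where
  complex : IsComplexStructure J
  metric : IsPseudoRiemannian g
  hermitian : ∀ (x : M) (v w : TangentSpace I x), g x (J x v) (J x w) = g x v w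
  closed : IsClosedTwoForm (kahlerForm J g)

/-- `b` is parallel: `(∇_X b)(Y, Z) = 0`. -/
def IsParallelBilin [IsManifold I 1 M] (nabla : Connection I M) (b : BilinField I M) : Prop :=
  ∀ X Y Z : VField I M, SmoothVField X → SmoothVField Y → SmoothVField Z →
    lieD X (evalField b Y Z) - evalField b (covD nabla X Y) Z - evalField b Y (covD nabla X Z) = 0

/-- The torsion of the connection vanishes. -/
def IsTorsionFree [IsManifold I 1 M] (nabla : Connection I M) : Prop :=
  ∀ X Y : VField I M, SmoothVField X → SmoothVField Y →
    covD nabla X Y - covD nabla Y X - VectorField.mlieBracket I X Y = 0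

/-- The curvature of the connection vanishes. -/
def IsFlat [IsManifold I 1 M] (nabla : Connection I M) : Prop :=
  ∀ X Y Z : VField I M, SmoothVField X → SmoothVField Y → SmoothVField Z →
    covD nabla X (covD nabla Y Z) - covD nabla Y (covD nabla X Z)
      - covD nabla (VectorField.mlieBracket I X Y) Z = 0

/-- `d^∇ J = 0`, where `J` is regarded as a 1-form with values in the tangent bundle. -/
def IsCovClosed [IsManifold I 1 M] (nabla : Connection I M) (J : EndField I M) : Prop :=
  ∀ X Y : VField I M, SmoothVField X → SmoothVField Y →
    covD nabla X (appField J Y) - covD nabla Y (appField J X)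
      - appField J (VectorField.mlieBracket I X Y) = 0

/-- `D` is the Levi-Civita connection of `g`. -/
structure IsLeviCivita [IsManifold I 1 M] (D : Connection I M) (g : BilinField I M) : Prop where
  torsionFree : IsTorsionFree D
  parallel : IsParallelBilin D g

/-- The distribution `span {ξ, J ξ}`. -/
def distr (J : EndField I M) (ξ : VField I M) (x : M) : Submodule ℝ (TangentSpace I x) :=
  Submodule.span ℝ {ξ x, J x (ξ x)}

/-- `(M, J, g, ∇, ξ)` is a conical affine special Kähler manifold. -/
structure IsConicalAffineSpecialKahler [IsManifold I 1 M] (J : EndField I M) (g : BilinField I M)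
    (nabla : Connection I M) (ξ : VField I M) : Prop where
  pseudoKahler : IsPseudoKahler J g
  smooth_nabla : CovariantDerivative.ContMDiffCovariantDerivative nabla ∞
  smooth_field : SmoothVField ξ
  flat : IsFlat nabla
  torsionFree : IsTorsionFree nabla
  parallel : IsParallelBilin nabla (kahlerForm J g)
  covClosed : IsCovClosed nabla J
  nabla_field : ∀ x : M, nabla ξ x = ContinuousLinearMap.id ℝ (TangentSpace I x)
  leviCivita_field : ∃ D : Connection I M, IsLeviCivita D g ∧
    ∀ x : M, D ξ x = ContinuousLinearMap.id ℝ (TangentSpace I x)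
  pos : ∀ (x : M), ∀ v ∈ distr J ξ x, v ≠ 0 → 0 < g x v v
  neg : ∀ (x : M) (v : TangentSpace I x), (∀ w ∈ distr J ξ x, g x v w = 0) → v ≠ 0 → g x v v < 0

/-- The function `f = g(ξ, ξ)`. -/
def potential (g : BilinField I M) (ξ : VField I M) : M → ℝ := fun x ↦ g x (ξ x) (ξ x)

/-- The degenerate symmetric tensor `g' = -g / f + (α² + (J^* α)²) / f²`, where `α = g(ξ, ·)`. -/
def horizontalForm (J : EndField I M) (g : BilinField I M) (ξ : VField I M)
    (x : M) (v w : TangentSpace I x) : ℝ :=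
  -(g x v w) / potential g ξ x
    + (g x (ξ x) v * g x (ξ x) w + g x (ξ x) (J x v) * g x (ξ x) (J x w)) / potential g ξ x ^ 2

end Geometry

section Action

/-- The element `exp z` of the group `ℂ^*`. -/
def expUnit (z : ℂ) : ℂˣ := Units.mk0 (Complex.exp z) (Complex.exp_ne_zero z)

variable {E : Type*} [NormedAddCommGroup E] [NormedSpace ℝ E]
  {H : Type*} [TopologicalSpace H] (I : ModelWithCorners ℝ E H)
  (M : Type*) [TopologicalSpace M] [ChartedSpace H M] [MulAction ℂˣ M]

/-- The action of `ℂ^*` on `M` is principal: smooth, free and proper. -/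
structure IsPrincipalAction : Prop where
  smooth : ContMDiff (𝓘(ℝ, ℂ).prod I) I ∞ (fun q : ℂˣ × M ↦ q.1 • q.2)
  free : ∀ (a : ℂˣ) (x : M), a • x = x → a = 1
  proper : ProperSMul ℂˣ M

variable {I M}

/-- `X` is the infinitesimal generator of the one-parameter group `t ↦ exp (t a)` of `ℂ^*`, for
the element `a` of the Lie algebra `ℂ` of `ℂ^*`. -/
def IsFundamentalField (a : ℂ) (X : VField I M) : Prop :=
  ∀ x : M, IsMIntegralCurve (fun t : ℝ ↦ expUnit (t * a) • x) X

/-- The vector fields `ξ` and `J ξ` generate the `ℂ^*`-action: they are the fundamental fields of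
two elements of the Lie algebra of `ℂ^*`. -/
def Generates (J : EndField I M) (ξ : VField I M) : Prop :=
  ∃ a b : ℂ, IsFundamentalField a ξ ∧ IsFundamentalField b (appField J ξ)

end Action

section Projective

variable {n : ℕ}
  {M : Type*} [TopologicalSpace M] [ChartedSpace (EuclideanSpace ℝ (Fin (2 * (n + 1)))) M]
  [IsManifold (𝓡 (2 * (n + 1))) ∞ M] [MulAction ℂˣ M]
  {B : Type*} [TopologicalSpace B] [ChartedSpace (EuclideanSpace ℝ (Fin (2 * n))) B]
  [IsManifold (𝓡 (2 * n)) ∞ B]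

/-- Riemannian metrics of class `C^∞` on a manifold without boundary of dimension `m`. -/
abbrev RMetric (m : ℕ) (B : Type*) [TopologicalSpace B] [ChartedSpace (EuclideanSpace ℝ (Fin m)) B]
    [IsManifold (𝓡 m) ∞ B] : Type _ :=
  ContMDiffRiemannianMetric (𝓡 m) ∞ (EuclideanSpace ℝ (Fin m))
    (fun x : B ↦ TangentSpace (𝓡 m) x)

/-- The Riemannian manifold `(B, h)` is complete: it is a complete space for the Riemannian
distance, the infimum of the lengths of `C^1` curves (`∞` between different components). -/
def IsCompleteMetric {m : ℕ} {B : Type*} [TopologicalSpace B] [T2Space B]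
    [ChartedSpace (EuclideanSpace ℝ (Fin m)) B] [IsManifold (𝓡 m) ∞ B] (h : RMetric m B) : Prop :=
  letI : RiemannianBundle (fun x : B ↦ TangentSpace (𝓡 m) x) := ⟨h.toRiemannianMetric⟩
  haveI : IsContinuousRiemannianBundle (EuclideanSpace ℝ (Fin m))
      (fun x : B ↦ TangentSpace (𝓡 m) x) :=
    ⟨h.inner, h.contMDiff.continuous, fun _ _ _ ↦ rfl⟩
  haveI : LocallyCompactSpace B := Manifold.locallyCompact_of_finiteDimensional (𝓡 m)
  letI : EMetricSpace B := EMetricSpace.ofRiemannianMetric (𝓡 m) B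
  CompleteSpace B

/-- `(B, h)` is the projective special Kähler manifold with underlying conical affine special
Kähler manifold `(M, J, g, ∇, ξ)` and canonical projection `pr : M → B = M / ℂ^*`. The quotient
manifold is characterized by `pr` being a surjective submersion whose fibres are the orbits, the
metric `h` by `pr^* h = g'`. -/
structure IsProjectiveSpecialKahler (J : EndField (𝓡 (2 * (n + 1))) M)
    (g : BilinField (𝓡 (2 * (n + 1))) M) (nabla : Connection (𝓡 (2 * (n + 1))) M)
    (ξ : VField (𝓡 (2 * (n + 1))) M) (pr : M → B) (h : RMetric (2 * n) B) : Prop where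
  conical : IsConicalAffineSpecialKahler J g nabla ξ
  principal : IsPrincipalAction (𝓡 (2 * (n + 1))) M
  generates : Generates J ξ
  smooth : ContMDiff (𝓡 (2 * (n + 1))) (𝓡 (2 * n)) ∞ pr
  surjective : Function.Surjective pr
  submersion : ∀ x : M, Function.Surjective (mfderiv (𝓡 (2 * (n + 1))) (𝓡 (2 * n)) pr x)
  fibre : ∀ x y : M, pr x = pr y ↔ ∃ a : ℂˣ, a • x = y
  pullback : ∀ (x : M) (v w : TangentSpace (𝓡 (2 * (n + 1))) x),
    h.inner (pr x) (mfderiv (𝓡 (2 * (n + 1))) (𝓡 (2 * n)) pr x v)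
      (mfderiv (𝓡 (2 * (n + 1))) (𝓡 (2 * n)) pr x w) = horizontalForm J g ξ x v w

end Projective

section Boundary

/-- The tangent space `T_p ∂N` of the boundary, as a subspace of `T_p N`, at a boundary point `p`
of a manifold with boundary: the vectors annihilated by the differential of the boundary
coordinate (the coordinate `0`, non-negative on the half space) of the chart at `p`. -/
def boundaryTangent {m : ℕ} [NeZero m] {N : Type*} [TopologicalSpace N]
    [ChartedSpace (EuclideanHalfSpace m) N] (p : N) : Submodule ℝ (TangentSpace (𝓡∂ m) p) where
  carrier := {v | (show EuclideanSpace ℝ (Fin m) from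
    mfderiv (𝓡∂ m) 𝓘(ℝ, EuclideanSpace ℝ (Fin m)) (extChartAt (𝓡∂ m) p) p v) 0 = 0}
  add_mem' := by
    intro v w hv hw
    simp only [Set.mem_ofPred_eq, map_add] at hv hw ⊢
    exact (congrArg₂ (· + ·) hv hw).trans (add_zero 0)
  zero_mem' := by
    simp only [Set.mem_ofPred_eq, map_zero]
    rfl
  smul_mem' := by
    intro c v hv
    simp only [Set.mem_ofPred_eq, map_smul] at hv ⊢
    exact (congrArg (c * ·) hv).trans (mul_zero c)

/-- The maximal complex subspace `H_p = T_p ∂N ∩ J (T_p ∂N)` of the tangent space of the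
boundary. -/
def complexBoundaryTangent {m : ℕ} [NeZero m] {N : Type*} [TopologicalSpace N]
    [ChartedSpace (EuclideanHalfSpace m) N] (J : EndField (𝓡∂ m) N) (p : N) :
    Submodule ℝ (TangentSpace (𝓡∂ m) p) :=
  boundaryTangent p ⊓ (boundaryTangent p).map (J p).toLinearMap

variable {m : ℕ} [NeZero m]
  {M : Type*} [TopologicalSpace M] [ChartedSpace (EuclideanSpace ℝ (Fin m)) M]
  [IsManifold (𝓡 m) ∞ M]
  {N : Type*} [TopologicalSpace N] [ChartedSpace (EuclideanHalfSpace m) N] [IsManifold (𝓡∂ m) ∞ N]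

/-- The manifold `(M, J, g, ξ)` has regular boundary behaviour with respect to the embedding
`i : M → N` onto the interior of the manifold with boundary `N`, where `J'`, `g'`, `ξ'` are the
smooth extensions of `J`, `g`, `ξ`. -/
structure HasRegularBoundary (J : EndField (𝓡 m) M) (g : BilinField (𝓡 m) M) (ξ : VField (𝓡 m) M)
    (i : M → N) (J' : EndField (𝓡∂ m) N) (g' : BilinField (𝓡∂ m) N) (ξ' : VField (𝓡∂ m) N) :
    Prop where
  embedding : IsSmoothEmbedding (𝓡 m) (𝓡∂ m) ∞ i
  range_eq : Set.range i = (𝓡∂ m).interior N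
  smooth_J : SmoothEndField J'
  smooth_g : SmoothBilinField g'
  smooth_field : SmoothVField ξ'
  extends_J : ∀ (x : M) (v : TangentSpace (𝓡 m) x),
    J' (i x) (mfderiv (𝓡 m) (𝓡∂ m) i x v) = mfderiv (𝓡 m) (𝓡∂ m) i x (J x v)
  extends_g : ∀ (x : M) (v w : TangentSpace (𝓡 m) x),
    g' (i x) (mfderiv (𝓡 m) (𝓡∂ m) i x v) (mfderiv (𝓡 m) (𝓡∂ m) i x w) = g x v w
  extends_field : ∀ x : M, ξ' (i x) = mfderiv (𝓡 m) (𝓡∂ m) i x (ξ x)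
  potential_eq_zero : ∀ p ∈ (𝓡∂ m).boundary N, potential g' ξ' p = 0
  differential_ne_zero : ∀ p ∈ (𝓡∂ m).boundary N, mvfderiv (𝓡∂ m) (potential g' ξ') p ≠ 0
  semidefinite : ∀ p ∈ (𝓡∂ m).boundary N, ∀ v ∈ complexBoundaryTangent J' p, g' p v v ≤ 0
  kernel : ∀ p ∈ (𝓡∂ m).boundary N, ∀ v : TangentSpace (𝓡∂ m) p,
    (v ∈ complexBoundaryTangent J' p ∧ ∀ w ∈ complexBoundaryTangent J' p, g' p v w = 0) ↔
      v ∈ distr J' ξ' p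

end Boundary

end SpecialKahler

end

noncomputable section

namespace SpecialKahler

section LinearEstimate

variable {E : Type*} [NormedAddCommGroup E] [InnerProductSpace ℝ E] [FiniteDimensional ℝ E]

/-- A quadratic form that is positive on the kernel of a nonnegative continuous function becomes
positive on the unit sphere after adding a large multiple of that function. -/
theorem exists_pos_add_mul_pos_on_sphere {a b : E → ℝ} (ha : Continuous a) (hb : Continuous b)
    (hb0 : ∀ v, 0 ≤ b v) (hab : ∀ v, v ≠ 0 → b v = 0 → 0 < a v) :
    ∃ L : ℝ, 0 < L ∧ ∀ v ∈ Metric.sphere (0 : E) 1, 0 < a v + L * b v := by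
  have hK : IsCompact (Metric.sphere (0 : E) 1) := isCompact_sphere 0 1
  obtain ⟨L, hL⟩ := hK.elim_directed_cover (fun L : ℕ ↦ {v | 0 < a v + (L : ℝ) * b v})
    (fun L ↦ isOpen_lt continuous_const (by fun_prop)) (by
      intro v hv
      rw [mem_iUnion]
      have hv0 : v ≠ 0 := by
        rintro rfl
        simp at hv
      rcases (hb0 v).eq_or_lt with h | h
      · exact ⟨0, by simpa using hab v hv0 h.symm⟩
      · obtain ⟨L, hL⟩ := exists_nat_gt (-a v / b v)
        refine ⟨L, ?_⟩
        rw [div_lt_iff₀ h] at hL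
        simp only [mem_ofPred_eq]
        linarith)
    (directed_of_isDirected_le (by
      intro L L' hLL' v hv
      simp only [mem_ofPred_eq] at hv ⊢
      have : (L : ℝ) * b v ≤ L' * b v :=
        mul_le_mul_of_nonneg_right (by exact_mod_cast hLL') (hb0 v)
      exact hv.trans_le (by simpa using this)))
  refine ⟨L + 1, by positivity, fun v hv ↦ ?_⟩
  have h1 : 0 < a v + (L : ℝ) * b v := hL hv
  nlinarith [hb0 v]

theorem scalar_estimate {c L t N a b γ : ℝ} (hc : 0 < c) (ht : 0 < t) (ht1 : t ≤ 1)
    (htL : t * (2 * L) ≤ 1) (hN : 0 ≤ N) (ha : 0 ≤ a) (hb : 0 ≤ b)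
    (key : c / 2 * N ≤ -γ + L * (a + b)) :
    N ≤ (2 / c + 2) * (-γ / t + (a + b) / t ^ 2) ∧
      a / t ^ 2 ≤ (2 / c + 2) * (-γ / t + (a + b) / t ^ 2) := by
  set q := -γ / t + (a + b) / t ^ 2 with hq
  have hqf : q * t ^ 2 = -γ * t + (a + b) := by
    rw [hq]; field_simp
  have h1 : c / 2 * N * t + (a + b) / 2 ≤ q * t ^ 2 := by
    rw [hqf]
    nlinarith [mul_le_mul_of_nonneg_right key ht.le,
      mul_le_mul_of_nonneg_left htL (add_nonneg ha hb)]
  have h2 : c / 2 * N ≤ q := by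
    have h3 : c / 2 * N * t ^ 2 ≤ q * t ^ 2 := by
      refine le_trans ?_ h1
      have : c / 2 * N * t ^ 2 ≤ c / 2 * N * t :=
        mul_le_mul_of_nonneg_left (by nlinarith) (by positivity)
      linarith
    exact le_of_mul_le_mul_right h3 (by positivity)
  have hq0 : 0 ≤ q := le_trans (by positivity) h2
  have h4 : a / t ^ 2 ≤ 2 * q := by
    rw [div_le_iff₀ (by positivity)]
    have : 0 ≤ c / 2 * N * t := by positivity
    linarith
  have h5 : N ≤ 2 / c * q := by
    rw [div_mul_eq_mul_div, le_div_iff₀ hc]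
    linarith
  have h6 : 0 ≤ 2 / c * q := by positivity
  constructor <;> linarith

set_option synthInstance.maxHeartbeats 200000 in
/-- Near a boundary point the form `-G / f + (α² + β²) / f²` controls, on the orthogonal complement
of two vector fields, both the norm and the logarithmic derivative `α / f`. -/
theorem exists_eventually_sq_norm_le_and_sq_div_le {ι : Type*} {l : Filter ι}
    {G : ι → E →L[ℝ] E →L[ℝ] ℝ} {X Y : ι → E} {α β : ι → E →L[ℝ] ℝ} {f : ι → ℝ}
    {G₀ : E →L[ℝ] E →L[ℝ] ℝ} {X₀ Y₀ : E} {α₀ β₀ : E →L[ℝ] ℝ}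
    (hG : Tendsto G l (𝓝 G₀)) (hX : Tendsto X l (𝓝 X₀)) (hY : Tendsto Y l (𝓝 Y₀))
    (hα : Tendsto α l (𝓝 α₀)) (hβ : Tendsto β l (𝓝 β₀)) (hf : Tendsto f l (𝓝 0))
    (hpos : ∀ᶠ x in l, 0 < f x)
    (hneg : ∀ v : E, v ≠ 0 → inner ℝ X₀ v = 0 → inner ℝ Y₀ v = 0 → α₀ v = 0 → β₀ v = 0 →
      G₀ v v < 0) :
    ∃ C : ℝ, 0 < C ∧ ∀ᶠ x in l, ∀ v : E, inner ℝ (X x) v = 0 → inner ℝ (Y x) v = 0 →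
      ‖v‖ ^ 2 ≤ C * (-(G x v v) / f x + (α x v ^ 2 + β x v ^ 2) / f x ^ 2) ∧
      (α x v / f x) ^ 2 ≤ C * (-(G x v v) / f x + (α x v ^ 2 + β x v ^ 2) / f x ^ 2) := by
  obtain ⟨L, hL0, hL⟩ := exists_pos_add_mul_pos_on_sphere
    (a := fun v ↦ -(G₀ v v))
    (b := fun v ↦ α₀ v ^ 2 + β₀ v ^ 2 + (inner ℝ X₀ v) ^ 2 + (inner ℝ Y₀ v) ^ 2)
    (by fun_prop) (by fun_prop) (fun v ↦ by positivity) (by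
      intro v hv h
      have h1 := sq_nonneg (α₀ v)
      have h2 := sq_nonneg (β₀ v)
      have h3 := sq_nonneg (inner ℝ X₀ v)
      have h4 := sq_nonneg (inner ℝ Y₀ v)
      have := hneg v hv (pow_eq_zero_iff two_ne_zero |>.1 (by linarith))
        (pow_eq_zero_iff two_ne_zero |>.1 (by linarith))
        (pow_eq_zero_iff two_ne_zero |>.1 (by linarith))
        (pow_eq_zero_iff two_ne_zero |>.1 (by linarith))
      linarith)
  let Q : (E →L[ℝ] E →L[ℝ] ℝ) × E × E × (E →L[ℝ] ℝ) × (E →L[ℝ] ℝ) → E → ℝ := fun d v ↦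
    -(d.1 v v) + L * (d.2.2.2.1 v ^ 2 + d.2.2.2.2 v ^ 2 + (inner ℝ d.2.1 v) ^ 2
      + (inner ℝ d.2.2.1 v) ^ 2)
  have hQ : Continuous (fun z : ((E →L[ℝ] E →L[ℝ] ℝ) × E × E × (E →L[ℝ] ℝ) × (E →L[ℝ] ℝ)) × E ↦
      Q z.1 z.2) := by
    simp only [Q]
    fun_prop
  have hK : IsCompact (Metric.sphere (0 : E) 1) := isCompact_sphere 0 1
  obtain ⟨c, hc0, hc⟩ := hK.exists_forall_le' (f := Q (G₀, X₀, Y₀, α₀, β₀)) (a := 0)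
    (by simp only [Q]; fun_prop) hL
  have hev : ∀ᶠ x in l, ∀ v ∈ Metric.sphere (0 : E) 1, c / 2 < Q (G x, X x, Y x, α x, β x) v := by
    have h1 : ∀ᶠ d in 𝓝 (G₀, X₀, Y₀, α₀, β₀), ∀ v ∈ Metric.sphere (0 : E) 1, c / 2 < Q d v := by
      refine hK.eventually_forall_of_forall_eventually fun v hv ↦ ?_
      refine hQ.continuousAt.eventually (lt_mem_nhds ?_)
      have := hc v hv
      simp only
      linarith
    exact (hG.prodMk_nhds (hX.prodMk_nhds (hY.prodMk_nhds (hα.prodMk_nhds hβ)))).eventually h1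
  have hf1 : ∀ᶠ x in l, f x < min 1 (1 / (2 * L)) := hf.eventually (gt_mem_nhds (by positivity))
  refine ⟨2 / c + 2, by positivity, ?_⟩
  filter_upwards [hev, hpos, hf1] with x hx hfx hfx1 v hXv hYv
  simp only [div_pow]
  have hf2 : f x * (2 * L) < 1 := by
    have := hfx1.trans_le (min_le_right _ _)
    rwa [lt_div_iff₀ (by positivity)] at this
  have hf3 : f x < 1 := hfx1.trans_le (min_le_left _ _)
  have key : c / 2 * ‖v‖ ^ 2 ≤ -(G x v v) + L * (α x v ^ 2 + β x v ^ 2) := by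
    rcases eq_or_ne v 0 with rfl | hv
    · simp
    · have hn : 0 < ‖v‖ := norm_pos_iff.2 hv
      have h1 := hx (‖v‖⁻¹ • v) (by simp [norm_smul, hn.ne'])
      simp only [Q, map_smul, smul_apply, smul_eq_mul, inner_smul_right, hXv,
        hYv, mul_zero] at h1
      have h2 := mul_lt_mul_of_pos_right h1 (pow_pos hn 2)
      refine h2.le.trans (le_of_eq ?_)
      field_simp
      ring
  exact scalar_estimate hc0 hfx hf3.le hf2.le (sq_nonneg _) (sq_nonneg _) (sq_nonneg _) key

end LinearEstimate

section CurveLifting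

/-- A curve in the target of a map with surjective strict derivative lifts locally, with any
initial velocity over the velocity of the curve. -/
theorem exists_lift_of_hasStrictFDerivAt {E F : Type*} [NormedAddCommGroup E] [NormedSpace ℝ E]
    [NormedAddCommGroup F] [NormedSpace ℝ F] [FiniteDimensional ℝ F]
    {f : E → F} {A : E →L[ℝ] F} {x : E} (hf : HasStrictFDerivAt f A x)
    (hA : Function.Surjective A) {c : ℝ → F} {t : ℝ} {v : E} (hc : HasDerivAt c (A v) t)
    (hct : c t = f x) :
    ∃ σ : ℝ → E, σ t = x ∧ HasDerivAt σ v t ∧ ∀ᶠ s in 𝓝 t, f (σ s) = c s := by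
  obtain ⟨R', hR'⟩ := A.toLinearMap.exists_rightInverse_of_surjective (LinearMap.range_eq_top.2 hA)
  let R : F →L[ℝ] E := LinearMap.toContinuousLinearMap R'
  have hAR : ∀ z, A (R z) = z := fun z ↦ LinearMap.congr_fun hR' z
  have : CompleteSpace F := FiniteDimensional.complete ℝ F
  let e : (ℝ × F) ≃L[ℝ] (ℝ × F) := ContinuousLinearEquiv.equivOfInverse
    ((ContinuousLinearMap.fst ℝ ℝ F).prod
      ((ContinuousLinearMap.fst ℝ ℝ F).smulRight (A v) + ContinuousLinearMap.snd ℝ ℝ F))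
    ((ContinuousLinearMap.fst ℝ ℝ F).prod
      (ContinuousLinearMap.snd ℝ ℝ F - (ContinuousLinearMap.fst ℝ ℝ F).smulRight (A v)))
    (fun z ↦ by simp) (fun z ↦ by simp)
  let p : ℝ × F → E := fun z ↦ x + (z.1 - t) • v + R z.2
  let K : ℝ × F → ℝ × F := fun z ↦ (z.1, f (p z))
  have hp0 : p (t, 0) = x := by simp [p]
  have hp : HasStrictFDerivAt p
      ((ContinuousLinearMap.fst ℝ ℝ F).smulRight v + R.comp (ContinuousLinearMap.snd ℝ ℝ F))
      (t, 0) := by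
    have h1 : HasStrictFDerivAt (fun z : ℝ × F ↦ z.1 - t) (ContinuousLinearMap.fst ℝ ℝ F) (t, 0) :=
      (ContinuousLinearMap.fst ℝ ℝ F).hasStrictFDerivAt.sub_const t
    have h2 := R.hasStrictFDerivAt.comp ((t, 0) : ℝ × F)
      (ContinuousLinearMap.snd ℝ ℝ F).hasStrictFDerivAt
    exact ((h1.smul_const v).const_add x).add h2
  have hK : HasStrictFDerivAt K (e : ℝ × F →L[ℝ] ℝ × F) (t, 0) := by
    have h1 : HasStrictFDerivAt (fun z ↦ f (p z)) _ ((t, 0) : ℝ × F) :=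
      HasStrictFDerivAt.comp ((t, 0) : ℝ × F) (by rw [hp0]; exact hf) hp
    refine ((ContinuousLinearMap.fst ℝ ℝ F).hasStrictFDerivAt.prodMk h1).congr_fderiv ?_
    ext z <;> simp [e, hAR]
  have hK0 : K (t, 0) = (t, c t) := by simp [K, hp0, hct]
  have hinv := hK.to_localInverse
  have hright := hK.eventually_right_inverse
  have himg := hK.localInverse_apply_image
  rw [hK0] at hinv hright himg
  set k := hK.localInverse with hk
  have hcurve : HasDerivAt (fun s ↦ (s, c s)) ((1 : ℝ), A v) t := (hasDerivAt_id t).prodMk hc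
  have hz : HasDerivAt (fun s ↦ k (s, c s)) ((1 : ℝ), (0 : F)) t := by
    have := hinv.hasFDerivAt.comp_hasDerivAt t hcurve
    convert! this using 1
    apply e.injective
    simp [e]
  have hcont : Tendsto (fun s ↦ (s, c s)) (𝓝 t) (𝓝 (t, c t)) := hcurve.continuousAt
  refine ⟨fun s ↦ x + (s - t) • v + R (k (s, c s)).2, ?_, ?_, ?_⟩
  · simp [himg]
  · have h1 : HasDerivAt (fun s ↦ R (k (s, c s)).2) (R 0) t :=
      R.hasFDerivAt.comp_hasDerivAt t
        ((ContinuousLinearMap.snd ℝ ℝ F).hasFDerivAt.comp_hasDerivAt t hz)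
    have h2 := (((((hasDerivAt_id t).sub_const t).smul_const v).const_add x)).add h1
    rw [map_zero, one_smul, add_zero] at h2
    exact h2
  · filter_upwards [hcont.eventually hright] with s hs
    have h1 : (k (s, c s)).1 = s := congrArg Prod.fst hs
    have h2 : f (p (k (s, c s))) = c s := congrArg Prod.snd hs
    simpa [p, h1] using h2

variable {E : Type*} [NormedAddCommGroup E] [NormedSpace ℝ E]
  {H : Type*} [TopologicalSpace H] {I : ModelWithCorners ℝ E H} [I.Boundaryless]
  {M : Type*} [TopologicalSpace M] [ChartedSpace H M]
  {E' : Type*} [NormedAddCommGroup E'] [NormedSpace ℝ E'] [FiniteDimensional ℝ E']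
  {H' : Type*} [TopologicalSpace H'] {I' : ModelWithCorners ℝ E' H'}
  {B : Type*} [TopologicalSpace B] [ChartedSpace H' B]
  {F : Type*} [NormedAddCommGroup F] [NormedSpace ℝ F]

/-- A curve in the target of a submersion lifts locally, with any initial velocity over the
velocity of the curve; the derivative of a function along the lift is prescribed accordingly. -/
theorem exists_lift_of_submersion {pr : M → B} {x : M} {n : WithTop ℕ∞} (hn : n ≠ 0)
    [IsManifold I n M] [IsManifold I' n B]
    (hpr : ContMDiffAt I I' n pr x) (hsurj : Function.Surjective (mfderiv I I' pr x))
    {γ : ℝ → B} {t : ℝ} (hγ : MDifferentiableAt 𝓘(ℝ, ℝ) I' γ t) (hγt : γ t = pr x)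
    {v : TangentSpace I x}
    (hv : (mfderiv I I' pr x v : E') = (mfderiv 𝓘(ℝ, ℝ) I' γ t (1 : ℝ) : E')) {Ψ : M → F}
    (hΨ : MDifferentiableAt I 𝓘(ℝ, F) Ψ x) :
    ∃ σ : ℝ → M, σ t = x ∧ ContinuousAt σ t ∧ (∀ᶠ s in 𝓝 t, pr (σ s) = γ s) ∧
      HasDerivAt (Ψ ∘ σ) (mfderiv I 𝓘(ℝ, F) Ψ x v : F) t := by
  have hprd : MDifferentiableAt I I' pr x := hpr.mdifferentiableAt hn
  let φ := extChartAt I x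
  let f : E → E' := writtenInExtChartAt I I' x pr
  have hf : ContDiffAt ℝ n f (φ x) := by
    have := (contMDiffAt_iff.1 hpr).2
    rwa [I.range_eq_univ, contDiffWithinAt_univ] at this
  have hfs : HasStrictFDerivAt f (mfderiv I I' pr x : E →L[ℝ] E') (φ x) := by
    have h2 : (mfderiv I I' pr x : E →L[ℝ] E') = fderivWithin ℝ f (range I) (φ x) := hprd.mfderiv
    rw [h2, I.range_eq_univ, fderivWithin_univ]
    exact hf.hasStrictFDerivAt hn
  let c : ℝ → E' := fun s ↦ extChartAt I' (pr x) (γ s)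
  have hc : HasDerivAt c ((mfderiv I I' pr x : E →L[ℝ] E') v) t := by
    obtain ⟨D, hD⟩ : ∃ D : ℝ →L[ℝ] E', D = mfderiv 𝓘(ℝ, ℝ) I' γ t := ⟨_, rfl⟩
    have h1 : HasFDerivWithinAt (fun s ↦ extChartAt I' (γ t) (γ s)) D (range id) t := by
      rw [hD]; exact hγ.hasMFDerivAt.2
    rw [range_id, hasFDerivWithinAt_univ, hγt] at h1
    have h2 : (mfderiv I I' pr x : E →L[ℝ] E') v = D 1 := by rw [hD]; exact hv
    rw [h2]
    exact h1.hasDerivAt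
  obtain ⟨τ, hτt, hτ, hτc⟩ := exists_lift_of_hasStrictFDerivAt hfs hsurj (v := v) hc (by
    simp [c, f, φ, writtenInExtChartAt, hγt])
  have hτcont : ContinuousAt τ t := hτ.continuousAt
  have hσ : ContinuousAt (fun s ↦ φ.symm (τ s)) t := by
    have h1 : ContinuousAt φ.symm (τ t) := by
      rw [hτt]; exact continuousAt_extChartAt_symm x
    exact h1.comp hτcont
  have hσt : φ.symm (τ t) = x := by rw [hτt]; exact extChartAt_to_inv x
  refine ⟨fun s ↦ φ.symm (τ s), hσt, hσ, ?_, ?_⟩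
  · have h1 : ∀ᶠ s in 𝓝 t, γ s ∈ (extChartAt I' (pr x)).source := by
      refine hγ.continuousAt.eventually ?_
      rw [hγt]
      exact extChartAt_source_mem_nhds (pr x)
    have h2 : ∀ᶠ s in 𝓝 t, pr (φ.symm (τ s)) ∈ (extChartAt I' (pr x)).source := by
      have h3 : ContinuousAt (fun s ↦ pr (φ.symm (τ s))) t :=
        ContinuousAt.comp (g := pr) (by rw [hσt]; exact hpr.continuousAt) hσ
      refine h3.eventually ?_
      simp only [hσt]
      exact extChartAt_source_mem_nhds (pr x)
    filter_upwards [h1, h2, hτc] with s hs1 hs2 hs3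
    exact (extChartAt I' (pr x)).injOn hs2 hs1 hs3
  · have h1 : HasFDerivAt (Ψ ∘ φ.symm) (mfderiv I 𝓘(ℝ, F) Ψ x : E →L[ℝ] F) (τ t) := by
      rw [hτt]
      obtain ⟨D, hD⟩ : ∃ D : E →L[ℝ] F, D = mfderiv I 𝓘(ℝ, F) Ψ x := ⟨_, rfl⟩
      have h2 : HasFDerivWithinAt (Ψ ∘ φ.symm) D (range I) (φ x) := by
        rw [hD]; exact hΨ.hasMFDerivAt.2
      rw [I.range_eq_univ, hasFDerivWithinAt_univ, hD] at h2
      exact h2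
    exact h1.comp_hasDerivAt t hτ

end CurveLifting

section PathLifting

/-- Continuous induction for lifting a curve through a map, with a function `Ψ` on the total space
whose variation along the lift is controlled. -/
theorem exists_mem_fibre_of_local_lifts {M B F : Type*} [TopologicalSpace M] [T2Space M]
    [TopologicalSpace B] [T2Space B] [NormedAddCommGroup F] {pr : M → B} (hpr : Continuous pr)
    {γ : ℝ → B} (hγ : Continuous γ) {Ψ : M → F} {U K : Set M} (hU : IsOpen U) (hK : IsCompact K)
    (hKU : K ⊆ U) (hΨ : ContinuousOn Ψ K) {Λ : ℝ → ℝ} (hΛ : Continuous Λ) {r : ℝ}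
    (hr : ∀ t ∈ Icc (0 : ℝ) 1, Λ t ≤ r) {x₀ : M} (hx₀ : x₀ ∈ U) (h0 : γ 0 = pr x₀)
    (hΛ0 : Λ 0 = 0) (hUK : ∀ x ∈ U, ‖Ψ x - Ψ x₀‖ ≤ r → x ∈ K)
    (hlift : ∀ t ∈ Ico (0 : ℝ) 1, ∀ x ∈ K, pr x = γ t → ∃ σ : ℝ → M, σ t = x ∧ ContinuousAt σ t ∧
      (∀ᶠ s in 𝓝 t, pr (σ s) = γ s) ∧ ∀ᶠ s in 𝓝[>] t, ‖Ψ (σ s) - Ψ x‖ ≤ Λ s - Λ t) :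
    ∃ x ∈ K, pr x = γ 1 := by
  let S : Set ℝ := {t | ∃ x ∈ K, pr x = γ t ∧ ‖Ψ x - Ψ x₀‖ ≤ Λ t}
  have hclosed : IsClosed (S ∩ Icc 0 1) := by
    have hC : IsCompact (Icc (0 : ℝ) 1 ×ˢ K) := isCompact_Icc.prod hK
    let T : Set (ℝ × M) := (Icc (0 : ℝ) 1 ×ˢ K) ∩ (fun z ↦ ‖Ψ z.2 - Ψ x₀‖ - Λ z.1) ⁻¹' Iic 0
      ∩ {z | pr z.2 = γ z.1}
    have hcont : ContinuousOn (fun z : ℝ × M ↦ ‖Ψ z.2 - Ψ x₀‖ - Λ z.1) (Icc (0 : ℝ) 1 ×ˢ K) := by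
      have h1 : ContinuousOn (fun z : ℝ × M ↦ Ψ z.2) (Icc (0 : ℝ) 1 ×ˢ K) :=
        hΨ.comp continuousOn_snd (fun z hz ↦ hz.2)
      fun_prop
    have hT : IsCompact T := by
      refine IsCompact.of_isClosed_subset hC ?_ (fun z hz ↦ hz.1.1)
      exact (hcont.preimage_isClosed_of_isClosed hC.isClosed isClosed_Iic).inter
        (isClosed_eq (by fun_prop) (by fun_prop))
    have himg : S ∩ Icc 0 1 = Prod.fst '' T := by
      ext t
      constructor
      · rintro ⟨⟨x, hx, h1, h2⟩, ht⟩
        exact ⟨(t, x), ⟨⟨⟨ht, hx⟩, by simpa using h2⟩, h1⟩, rfl⟩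
      · rintro ⟨⟨t', x⟩, ⟨⟨⟨ht, hx⟩, h2⟩, h1⟩, rfl⟩
        exact ⟨⟨x, hx, h1, by simpa using h2⟩, ht⟩
    rw [himg]
    exact (hT.image continuous_fst).isClosed
  have hstart : (0 : ℝ) ∈ S := by
    refine ⟨x₀, hUK x₀ hx₀ ?_, h0.symm, by simp [hΛ0]⟩
    have := hr 0 (by simp)
    simpa [hΛ0] using this
  have hsub : Icc (0 : ℝ) 1 ⊆ S := by
    refine hclosed.Icc_subset_of_forall_exists_gt hstart ?_
    rintro t ⟨⟨x, hx, hxt, hxΛ⟩, ht⟩ y hy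
    obtain ⟨σ, hσt, hσc, hσpr, hσΨ⟩ := hlift t ht x hx hxt
    have hU' : ∀ᶠ s in 𝓝 t, σ s ∈ U := hσc.eventually (hU.mem_nhds (by rw [hσt]; exact hKU hx))
    have h1 : Ioc t (min y 1) ∈ 𝓝[>] t := Ioc_mem_nhdsGT (lt_min hy ht.2)
    obtain ⟨s, ⟨hs1, hs2⟩, hs3, hs4⟩ :=
      (((hU'.and hσpr).filter_mono nhdsWithin_le_nhds).and (hσΨ.and h1)).exists
    have hsΛ : ‖Ψ (σ s) - Ψ x₀‖ ≤ Λ s := by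
      calc ‖Ψ (σ s) - Ψ x₀‖ ≤ ‖Ψ (σ s) - Ψ x‖ + ‖Ψ x - Ψ x₀‖ := norm_sub_le_norm_sub_add_norm_sub ..
        _ ≤ Λ s := by linarith
    refine ⟨s, ⟨σ s, hUK _ hs1 (hsΛ.trans (hr s ?_)), hs2, hsΛ⟩, hs4.1, hs4.2.trans (min_le_left _ _)⟩
    exact ⟨ht.1.trans hs4.1.le, hs4.2.trans (min_le_right _ _)⟩
  obtain ⟨x, hx, hx1, -⟩ := hsub (right_mem_Icc.2 zero_le_one)
  exact ⟨x, hx, hx1⟩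

theorem eventually_norm_sub_le_sub_of_hasDerivAt {F : Type*} [NormedAddCommGroup F]
    [NormedSpace ℝ F] {u : ℝ → F} {Λ : ℝ → ℝ} {u' : F} {Λ' t : ℝ} (hu : HasDerivAt u u' t)
    (hΛ : HasDerivAt Λ Λ' t) (h : ‖u'‖ < Λ') :
    ∀ᶠ s in 𝓝[>] t, ‖u s - u t‖ ≤ Λ s - Λ t := by
  obtain ⟨m, hm1, hm2⟩ := exists_between h
  have h1 := (hu.hasDerivWithinAt (s := Ioi t)).limsup_norm_slope_le hm1
  have h2 : ∀ᶠ s in 𝓝[>] t, m < slope Λ t s :=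
    ((hasDerivAt_iff_tendsto_slope.1 hΛ).mono_left (nhdsWithin_mono _ fun s hs ↦ ne_of_gt hs)).eventually
      (lt_mem_nhds hm2)
  filter_upwards [h1, h2, self_mem_nhdsWithin] with s hs1 hs2 hs3
  have hst : 0 < s - t := sub_pos.2 hs3
  rw [Real.norm_of_nonneg hst.le, inv_mul_lt_iff₀ hst] at hs1
  rw [slope_def_field, lt_div_iff₀ hst] at hs2
  linarith

variable {E : Type*} [NormedAddCommGroup E] [NormedSpace ℝ E]
  {H : Type*} [TopologicalSpace H] {I : ModelWithCorners ℝ E H} [I.Boundaryless]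
  {M : Type*} [TopologicalSpace M] [T2Space M] [ChartedSpace H M] [IsManifold I 1 M]
  {E' : Type*} [NormedAddCommGroup E'] [NormedSpace ℝ E'] [FiniteDimensional ℝ E']
  {H' : Type*} [TopologicalSpace H'] {I' : ModelWithCorners ℝ E' H'}
  {B : Type*} [TopologicalSpace B] [T2Space B] [ChartedSpace H' B] [IsManifold I' 1 B]
  [RiemannianBundle (fun x : B ↦ TangentSpace I' x)]
  [IsContinuousRiemannianBundle E' (fun x : B ↦ TangentSpace I' x)]
  {F : Type*} [NormedAddCommGroup F] [NormedSpace ℝ F]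

omit [FiniteDimensional ℝ E'] [T2Space B] in
theorem continuous_norm_mfderiv_curve {γ : ℝ → B} (hγ : ContMDiff 𝓘(ℝ, ℝ) I' 1 γ) :
    Continuous (fun t ↦ ‖mfderiv 𝓘(ℝ, ℝ) I' γ t (1 : ℝ)‖) := by
  have h1 : Continuous (fun t : ℝ ↦
      (TotalSpace.mk' E' (γ t) (mfderiv 𝓘(ℝ, ℝ) I' γ t (1 : ℝ)) : TangentBundle I' B)) := by
    have h2 := hγ.continuous_tangentMap le_rfl
    have h3 : Continuous (fun t : ℝ ↦ (TotalSpace.mk' ℝ t (1 : ℝ) : TangentBundle 𝓘(ℝ, ℝ) ℝ)) := by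
      have : ContMDiff 𝓘(ℝ, ℝ) (𝓘(ℝ, ℝ).prod 𝓘(ℝ, ℝ)) 1
          (fun t : ℝ ↦ (TotalSpace.mk' ℝ t (1 : ℝ) : TangentBundle 𝓘(ℝ, ℝ) ℝ)) :=
        (contMDiff_vectorSpace_iff_contDiff (V := fun _ ↦ (1 : ℝ))).2 contDiff_const
      exact this.continuous
    exact h2.comp h3
  have h4 := h1.inner_bundle h1
  have h5 : (fun t ↦ ‖mfderiv 𝓘(ℝ, ℝ) I' γ t (1 : ℝ)‖) = fun t ↦ Real.sqrt
      (inner ℝ (mfderiv 𝓘(ℝ, ℝ) I' γ t (1 : ℝ)) (mfderiv 𝓘(ℝ, ℝ) I' γ t (1 : ℝ))) := by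
    ext t
    rw [real_inner_self_eq_norm_sq, Real.sqrt_sq (norm_nonneg _)]
  rw [h5]
  exact Real.continuous_sqrt.comp h4

/-- If tangent vectors of the base of a submersion `pr` have lifts along which `Ψ` varies at a
controlled rate, then a short curve starting at `pr x₀` ends in the image of a given compact set. -/
theorem exists_mem_fibre_of_pathELength_lt {pr : M → B} (hpr : ContMDiff I I' 1 pr)
    (hsurj : ∀ x, Function.Surjective (mfderiv I I' pr x)) {Ψ : M → F} {U K : Set M}
    (hU : IsOpen U) (hK : IsCompact K) (hKU : K ⊆ U)
    (hΨ : ∀ x ∈ U, MDifferentiableAt I 𝓘(ℝ, F) Ψ x) {C r : ℝ} (hC : 0 < C)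
    (hctrl : ∀ x ∈ U, ∀ w : TangentSpace I' (pr x), ∃ v : TangentSpace I x,
      mfderiv I I' pr x v = w ∧ ‖mvfderiv I Ψ x v‖ ≤ C * ‖w‖)
    {x₀ : M} (hx₀ : x₀ ∈ U) (hUK : ∀ x ∈ U, ‖Ψ x - Ψ x₀‖ ≤ r → x ∈ K)
    {γ : ℝ → B} (hγ : ContMDiff 𝓘(ℝ, ℝ) I' 1 γ) (h0 : γ 0 = pr x₀)
    (hlen : pathELength I' γ 0 1 < ENNReal.ofReal (r / C)) :
    ∃ x ∈ K, pr x = γ 1 := by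
  let sp : ℝ → ℝ := fun t ↦ ‖mfderiv 𝓘(ℝ, ℝ) I' γ t (1 : ℝ)‖
  have hsp : Continuous sp := continuous_norm_mfderiv_curve hγ
  have hsp0 : ∀ t, 0 ≤ sp t := fun t ↦ norm_nonneg _
  have hlen' : ∫ t in (0 : ℝ)..1, sp t < r / C := by
    have h1 : pathELength I' γ 0 1 = ENNReal.ofReal (∫ t in (0 : ℝ)..1, sp t) := by
      rw [pathELength_eq_lintegral_mfderiv_Icc, intervalIntegral.integral_of_le zero_le_one,
        ← MeasureTheory.integral_Icc_eq_integral_Ioc, MeasureTheory.ofReal_integral_eq_lintegral_ofReal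
        (hsp.continuousOn.integrableOn_compact isCompact_Icc) (Eventually.of_forall hsp0)]
      exact MeasureTheory.lintegral_congr fun t ↦ (ofReal_norm _).symm
    rw [h1] at hlen
    exact (ENNReal.ofReal_lt_ofReal_iff_of_nonneg
      (intervalIntegral.integral_nonneg zero_le_one fun t _ ↦ hsp0 t)).1 hlen
  rw [lt_div_iff₀ hC] at hlen'
  let η := r - (∫ t in (0 : ℝ)..1, sp t) * C
  have hη : 0 < η := sub_pos.2 hlen'
  let ρ : ℝ → ℝ := fun t ↦ C * sp t + η
  have hρ : Continuous ρ := by fun_prop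
  have hρ0 : ∀ t, 0 ≤ ρ t := fun t ↦ by have := hsp0 t; positivity
  let Λ : ℝ → ℝ := fun t ↦ ∫ s in (0 : ℝ)..t, ρ s
  have hΛd : ∀ t, HasDerivAt Λ (ρ t) t := fun t ↦ hρ.integral_hasStrictDerivAt 0 t |>.hasDerivAt
  have hΛ1 : Λ 1 = r := by
    simp only [Λ, ρ, η]
    rw [intervalIntegral.integral_add (by apply Continuous.intervalIntegrable; fun_prop)
      (by apply Continuous.intervalIntegrable; fun_prop)]
    simp
    ring
  have hmono : Monotone Λ := monotone_of_hasDerivAt_nonneg hΛd hρ0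
  refine exists_mem_fibre_of_local_lifts hpr.continuous hγ.continuous hU hK hKU
    (fun x hx ↦ (hΨ x (hKU hx)).continuousAt.continuousWithinAt)
    (continuous_iff_continuousAt.2 fun t ↦ (hΛd t).continuousAt)
    (fun t ht ↦ (hmono ht.2).trans_eq hΛ1) hx₀ h0 (by simp [Λ]) hUK ?_
  intro t ht x hx hxt
  have hv : ∀ b, pr x = b → ∀ w : TangentSpace I' b, ∃ v : TangentSpace I x,
      (mfderiv I I' pr x v : E') = (w : E') ∧ ‖mvfderiv I Ψ x v‖ ≤ C * ‖w‖ := by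
    rintro _ rfl w
    exact hctrl x (hKU hx) w
  obtain ⟨v, hv1, hv2⟩ := hv (γ t) hxt (mfderiv 𝓘(ℝ, ℝ) I' γ t (1 : ℝ))
  obtain ⟨σ, hσt, hσc, hσpr, hσΨ⟩ := exists_lift_of_submersion one_ne_zero (hpr x) (hsurj x)
    (hγ.mdifferentiableAt one_ne_zero) hxt.symm hv1 (hΨ x (hKU hx))
  refine ⟨σ, hσt, hσc, hσpr, ?_⟩
  have := eventually_norm_sub_le_sub_of_hasDerivAt hσΨ (hΛd t) (by
    refine hv2.trans_lt ?_
    simp only [ρ, sp]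
    linarith)
  simpa [hσt] using this

end PathLifting

section Completeness

/-- An extended metric space in which every point of a compact parameter space yields balls of a
uniform radius contained in compact sets is complete. -/
theorem completeSpace_of_locally_uniform_compact_balls {B Q : Type*} [PseudoEMetricSpace B]
    [TopologicalSpace Q] [CompactSpace Q] (κ : B → Q)
    (h : ∀ q : Q, ∃ δ > 0, ∃ V ∈ 𝓝 q, ∀ b : B, κ b ∈ V →
      ∃ K : Set B, IsCompact K ∧ Metric.eball b δ ⊆ K) : CompleteSpace B := by
  refine ⟨fun {F} hF ↦ ?_⟩
  have := hF.1
  obtain ⟨q, hq⟩ := exists_clusterPt_of_compactSpace (map κ F)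
  obtain ⟨δ, hδ, V, hV, hVK⟩ := h q
  obtain ⟨A, hA, hAδ⟩ := (EMetric.cauchy_iff.1 hF).2 δ hδ
  obtain ⟨_, hbV, b, hbA, rfl⟩ := clusterPt_iff_nonempty.1 hq hV (image_mem_map hA)
  obtain ⟨K, hK, hbK⟩ := hVK b hbV
  have hAK : A ⊆ K := fun a ha ↦ hbK (hAδ a ha b hbA)
  obtain ⟨x, -, hx⟩ := hK.isComplete F hF (le_principal_iff.2 (mem_of_superset hA hAK))
  exact ⟨x, hx⟩

end Completeness

section Coordinates

variable {E : Type*} [NormedAddCommGroup E] [NormedSpace ℝ E]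
  {H : Type*} [TopologicalSpace H] {I : ModelWithCorners ℝ E H}
  {N : Type*} [TopologicalSpace N] [ChartedSpace H N]

section

variable [IsManifold I 1 N]

variable (I) in
/-- The coordinates of a tangent vector at `x` in the trivialization at `p`. -/
def tangentCoord (p x : N) : TangentSpace I x →L[ℝ] E :=
  (trivializationAt E (TangentSpace I) p).continuousLinearMapAt ℝ x

variable (I) in
/-- The tangent vector at `x` with given coordinates in the trivialization at `p`. -/
def tangentCoordSymm (p x : N) : E →L[ℝ] TangentSpace I x :=
  (trivializationAt E (TangentSpace I) p).symmL ℝ x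

/-- The coordinate representation of an endomorphism field in the trivialization at `p`. -/
def endCoord (J : EndField I N) (p x : N) : E →L[ℝ] E :=
  ContinuousLinearMap.inCoordinates E (TangentSpace I : N → Type _) E (TangentSpace I : N → Type _)
    p x p x (J x)

/-- The coordinate representation of a field of bilinear forms in the trivialization at `p`. -/
def bilinCoord (g : BilinField I N) (p x : N) : E →L[ℝ] E →L[ℝ] ℝ :=
  ContinuousLinearMap.inCoordinates E (TangentSpace I : N → Type _) (E →L[ℝ] ℝ)
    (fun y : N ↦ TangentSpace I y →L[ℝ] ℝ) p x p x (g x)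

theorem tangentCoord_symm {p x : N} (hx : x ∈ (chartAt H p).source) (e : E) :
    tangentCoord I p x (tangentCoordSymm I p x e) = e :=
  (trivializationAt E (TangentSpace I) p).continuousLinearMapAt_symmL hx e

theorem tangentCoordSymm_coord {p x : N} (hx : x ∈ (chartAt H p).source) (v : TangentSpace I x) :
    tangentCoordSymm I p x (tangentCoord I p x v) = v :=
  (trivializationAt E (TangentSpace I) p).symmL_continuousLinearMapAt hx v

theorem tangentCoord_eq_mfderiv {p x : N} (hx : x ∈ (chartAt H p).source) (v : TangentSpace I x) :
    tangentCoord I p x v = mfderiv I 𝓘(ℝ, E) (extChartAt I p) x v :=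
  DFunLike.congr_fun (TangentBundle.continuousLinearMapAt_trivializationAt hx) v

theorem tangentCoord_self (p : N) (v : TangentSpace I p) : tangentCoord I p p v = v := by
  rw [tangentCoord_eq_mfderiv (mem_chart_source H p), mfderiv_extChartAt_self]
  rfl

theorem tangentCoordSymm_self (p : N) (e : E) : tangentCoordSymm I p p e = e := by
  rw [← tangentCoord_self p (tangentCoordSymm I p p e), tangentCoord_symm (mem_chart_source H p)]

theorem endCoord_apply (J : EndField I N) (p x : N) (e : E) :
    endCoord J p x e = tangentCoord I p x (J x (tangentCoordSymm I p x e)) := rfl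

theorem endCoord_coord (J : EndField I N) {p x : N} (hx : x ∈ (chartAt H p).source)
    (v : TangentSpace I x) :
    endCoord J p x (tangentCoord I p x v) = tangentCoord I p x (J x v) := by
  rw [endCoord_apply, tangentCoordSymm_coord hx]

theorem bilinCoord_apply (g : BilinField I N) {p x : N} (hx : x ∈ (chartAt H p).source) (e e' : E) :
    bilinCoord g p x e e' = g x (tangentCoordSymm I p x e) (tangentCoordSymm I p x e') := by
  have := inCoordinates_apply_eq₂ (𝕜 := ℝ) (F₁ := E) (F₂ := E) (F₃ := ℝ)
    (E₁ := (TangentSpace I : N → Type _)) (E₂ := (TangentSpace I : N → Type _))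
    (E₃ := Bundle.Trivial N ℝ) (x₀ := p) (x := x) (ϕ := g x) (v := e) (w := e') hx hx (mem_univ _)
  refine this.trans ?_
  have hx' : x ∈ (trivializationAt E (TangentSpace I) p).baseSet := hx
  simp [tangentCoordSymm, Trivialization.symmL_apply _ hx']

theorem bilinCoord_coord (g : BilinField I N) {p x : N} (hx : x ∈ (chartAt H p).source)
    (v w : TangentSpace I x) :
    bilinCoord g p x (tangentCoord I p x v) (tangentCoord I p x w) = g x v w := by
  rw [bilinCoord_apply g hx, tangentCoordSymm_coord hx, tangentCoordSymm_coord hx]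

theorem SmoothVField.continuousAt_coord {X : VField I N} (hX : SmoothVField X) (p : N) :
    ContinuousAt (fun x ↦ tangentCoord I p x (X x)) p := by
  have h1 := ((contMDiffAt_section p).1 (hX p)).continuousAt
  refine h1.congr ?_
  filter_upwards [(chartAt H p).open_source.mem_nhds (mem_chart_source H p)] with x hx
  exact ((trivializationAt E (TangentSpace I) p).continuousLinearMapAt_apply_of_mem _ hx _).symm

theorem SmoothEndField.continuousAt_coord {J : EndField I N} (hJ : SmoothEndField J) (p : N) :
    ContinuousAt (fun x ↦ endCoord J p x) p :=
  ((contMDiffAt_section p).1 (hJ p)).continuousAt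

theorem SmoothBilinField.continuousAt_coord {g : BilinField I N} (hg : SmoothBilinField g) (p : N) :
    ContinuousAt (fun x ↦ bilinCoord g p x) p :=
  ((contMDiffAt_section p).1 (hg p)).continuousAt

end

theorem SmoothBilinField.contMDiff_evalField [IsManifold I ∞ N] {g : BilinField I N}
    (hg : SmoothBilinField g) {X Y : VField I N}
    (hX : SmoothVField X) (hY : SmoothVField Y) : ContMDiff I 𝓘(ℝ, ℝ) ∞ (evalField g X Y) := by
  intro x
  have h1 : ContMDiffAt I (I.prod 𝓘(ℝ)) ∞
      (fun m ↦ TotalSpace.mk' ℝ (E := Bundle.Trivial N ℝ) m (g m (X m) (Y m))) x := by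
    apply ContMDiffAt.clm_bundle_apply₂ (F₁ := E) (F₂ := E)
    · exact hg x
    · exact hX x
    · exact hY x
  exact (contMDiffAt_totalSpace.1 h1).2

theorem continuousAt_mvfderiv_coord [IsManifold I ∞ N] {f : N → ℝ} (hf : ContMDiff I 𝓘(ℝ, ℝ) ∞ f)
    (p : N) :
    ContinuousAt (fun x ↦ (mvfderiv I f x).comp (tangentCoordSymm I p x)) p := by
  have h1 := (ContMDiffAt.mfderiv_const (m := 0) (hf p) (by simp)).continuousAt
  refine h1.congr ?_
  filter_upwards [(chartAt H p).open_source.mem_nhds (mem_chart_source H p)] with x hx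
  ext e
  simp [inTangentCoordinates, ContinuousLinearMap.inCoordinates]
  rfl

end Coordinates

section VectorFields

variable {E : Type*} [NormedAddCommGroup E] [NormedSpace ℝ E] [FiniteDimensional ℝ E]
  {H : Type*} [TopologicalSpace H] {I : ModelWithCorners ℝ E H}
  {M : Type*} [TopologicalSpace M] [ChartedSpace H M] [IsManifold I ∞ M]
  [T2Space M] [SigmaCompactSpace M]

theorem exists_smoothVField_apply_eq (x : M) (v : TangentSpace I x) :
    ∃ X : VField I M, SmoothVField X ∧ X x = v := by
  classical
  let t : ∀ y : M, Set (TangentSpace I y) := fun y ↦ {w | ∀ h : y = x, h ▸ w = v}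
  have ht : ∀ y, Convex ℝ (t y) := by
    intro y
    by_cases h : y = x
    · subst h
      simp [t]
    · simp [t, h, convex_univ]
  have hloc : ∀ y : M, ∃ U ∈ 𝓝 y, ∃ X : VField I M,
      ContMDiffOn I (I.prod 𝓘(ℝ, E)) ∞ (fun z ↦ TotalSpace.mk' E z (X z)) U ∧
        ∀ z ∈ U, X z ∈ t z := by
    intro y
    by_cases h : y = x
    · subst h
      obtain ⟨U, hU, hs⟩ := FiberBundle.exists_contMDiffOn_extend (k := ∞) I E v
      refine ⟨U, hU, FiberBundle.extend E v, hs, fun z hz h ↦ ?_⟩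
      subst h
      simp
    · refine ⟨{x}ᶜ, isOpen_compl_singleton.mem_nhds h, fun _ ↦ 0, ?_, fun z hz h' ↦ (hz h').elim⟩
      exact (contMDiff_zeroSection ℝ (TangentSpace I : M → Type _)).contMDiffOn
  obtain ⟨s, hs⟩ := exists_contMDiffSection_forall_mem_convex_of_local (n := ⊤) I
    (TangentSpace I : M → Type _) t ht hloc
  exact ⟨s, s.contMDiff, hs x rfl⟩

theorem mvfderiv_potential {g : BilinField I M} {ξ : VField I M} (hξ : SmoothVField ξ)
    (hsymm : ∀ (x : M) (v w : TangentSpace I x), g x v w = g x w v)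
    {D : Connection I M} (hD : IsParallelBilin D g)
    (hDξ : ∀ x : M, D ξ x = ContinuousLinearMap.id ℝ (TangentSpace I x))
    (x : M) (v : TangentSpace I x) : mvfderiv I (potential g ξ) x v = 2 * g x (ξ x) v := by
  obtain ⟨X, hX, rfl⟩ := exists_smoothVField_apply_eq x v
  have h1 := congrFun (hD X ξ ξ hX hξ hξ) x
  simp only [Pi.sub_apply, Pi.zero_apply, lieD, evalField, covD, hDξ,
    ContinuousLinearMap.id_apply] at h1
  have h2 := hsymm x (X x) (ξ x)
  have h3 : mvfderiv I (potential g ξ) x (X x) - g x (X x) (ξ x) - g x (ξ x) (X x) = 0 := h1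
  linarith

end VectorFields

section BoundaryEstimate

theorem eq_zero_of_semidefinite_of_self_eq_zero {V : Type*} [AddCommGroup V] [Module ℝ V]
    {b : V → V → ℝ} (hadd : ∀ u v w z, b (u + v) (w + z) = b u w + b u z + b v w + b v z)
    (hsmul : ∀ (s t : ℝ) u v, b (s • u) (t • v) = s * t * b u v) (hsymm : ∀ u v, b u v = b v u)
    (S : Submodule ℝ V) (hS : ∀ v ∈ S, b v v ≤ 0) {v : V} (hv : v ∈ S) (hvv : b v v = 0)
    {w : V} (hw : w ∈ S) : b v w = 0 := by
  by_contra hne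
  have h1 : ∀ t : ℝ, 2 * t * b v w + t ^ 2 * b w w ≤ 0 := by
    intro t
    have h2 := hS _ (S.add_mem hv (S.smul_mem t hw))
    have h3 := hsmul 1 t v w
    have h4 := hsmul t 1 w v
    rw [one_smul] at h3 h4
    rw [hadd, hsmul, h3, h4, hsymm w v, hvv] at h2
    linarith
  have hc := hS w hw
  have hpos : 0 < 1 - b w w := by linarith
  have h5 := h1 (b v w / (1 - b w w))
  have h6 : 2 * (b v w / (1 - b w w)) * b v w + (b v w / (1 - b w w)) ^ 2 * b w w
      = (b v w) ^ 2 * (2 - b w w) / (1 - b w w) ^ 2 := by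
    field_simp
    ring
  rw [h6] at h5
  have h7 : 0 < (b v w) ^ 2 * (2 - b w w) / (1 - b w w) ^ 2 :=
    div_pos (mul_pos (by positivity) (by linarith)) (by positivity)
  linarith

theorem tendsto_clm_apply {ι E F : Type*} [NormedAddCommGroup E] [NormedSpace ℝ E]
    [NormedAddCommGroup F] [NormedSpace ℝ F] {l : Filter ι} {A : ι → E →L[ℝ] F} {A₀ : E →L[ℝ] F}
    {v : ι → E} {v₀ : E} (hA : Tendsto A l (𝓝 A₀)) (hv : Tendsto v l (𝓝 v₀)) :
    Tendsto (fun x ↦ A x (v x)) l (𝓝 (A₀ v₀)) :=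
  (isBoundedBilinearMap_apply.continuous.tendsto (A₀, v₀)).comp (hA.prodMk_nhds hv)

variable {m : ℕ} [NeZero m]
  {M : Type*} [TopologicalSpace M] [ChartedSpace (EuclideanSpace ℝ (Fin m)) M]
  {N : Type*} [TopologicalSpace N] [ChartedSpace (EuclideanHalfSpace m) N] [IsManifold (𝓡∂ m) ∞ N]

omit [IsManifold (𝓡∂ m) ∞ N] in
/-- At a boundary point, the differential of a nonnegative function vanishing there annihilates the
tangent space of the boundary. -/
theorem mvfderiv_eq_zero_of_nonneg {f : N → ℝ} {p : N} (hf : MDifferentiableAt (𝓡∂ m) 𝓘(ℝ, ℝ) f p)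
    (hp : p ∈ (𝓡∂ m).boundary N) (hf0 : ∀ x, 0 ≤ f x) (hfp : f p = 0)
    {e : EuclideanSpace ℝ (Fin m)} (he : e 0 = 0) : mvfderiv (𝓡∂ m) f p e = 0 := by
  let φ := extChartAt (𝓡∂ m) p
  have hφ : φ p ∈ frontier (range (𝓡∂ m)) := hp
  rw [frontier_range_modelWithCornersEuclideanHalfSpace] at hφ
  have hφ0 : (φ p) 0 = 0 := Eq.symm hφ
  obtain ⟨A, hA⟩ : ∃ A : EuclideanSpace ℝ (Fin m) →L[ℝ] ℝ, A = mvfderiv (𝓡∂ m) f p := ⟨_, rfl⟩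
  have h1 : HasFDerivWithinAt (f ∘ φ.symm) A (range (𝓡∂ m)) (φ p) := by
    rw [hA]; exact hf.hasMFDerivAt.2
  have h2 : HasDerivAt (fun t : ℝ ↦ φ p + t • e) e 0 := by
    simpa using ((hasDerivAt_id (0 : ℝ)).smul_const e).const_add (φ p)
  have h3 : HasDerivAt (fun t : ℝ ↦ (f ∘ φ.symm) (φ p + t • e)) (A e) 0 := by
    rw [← hasDerivWithinAt_univ]
    refine HasFDerivWithinAt.comp_hasDerivWithinAt_of_eq (t := range (𝓡∂ m)) 0 h1
      h2.hasDerivWithinAt ?_ (by simp)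
    intro t _
    rw [range_modelWithCornersEuclideanHalfSpace]
    simp [hφ0, he]
  have h4 : IsLocalMin (fun t : ℝ ↦ (f ∘ φ.symm) (φ p + t • e)) 0 := by
    refine Eventually.of_forall fun t ↦ ?_
    have h5 : φ.symm (φ p) = p := extChartAt_to_inv p
    simp [h5, hfp, hf0]
  have := h4.hasDerivAt_eq_zero h3
  rw [← hA]
  exact this

variable {J : EndField (𝓡 m) M} {g : BilinField (𝓡 m) M} {ξ : VField (𝓡 m) M}
  {i : M → N} {J' : EndField (𝓡∂ m) N} {g' : BilinField (𝓡∂ m) N} {ξ' : VField (𝓡∂ m) N}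

namespace HasRegularBoundary

theorem mdifferentiableAt_embedding (hreg : HasRegularBoundary J g ξ i J' g' ξ') (x : M) :
    MDifferentiableAt (𝓡 m) (𝓡∂ m) i x :=
  hreg.embedding.contMDiff.mdifferentiable (by simp) x

theorem surjective_mfderiv (hreg : HasRegularBoundary J g ξ i J' g' ξ')
    (hg : ∀ (x : M) (v : TangentSpace (𝓡 m) x), (∀ w, g x v w = 0) → v = 0) (x : M) :
    Function.Surjective (mfderiv (𝓡 m) (𝓡∂ m) i x) := by
  obtain ⟨A, hA⟩ : ∃ A : EuclideanSpace ℝ (Fin m) →L[ℝ] EuclideanSpace ℝ (Fin m),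
    A = mfderiv (𝓡 m) (𝓡∂ m) i x := ⟨_, rfl⟩
  have hinj : Function.Injective A.toLinearMap := by
    rw [injective_iff_map_eq_zero]
    intro v hv
    replace hv : A v = 0 := hv
    rw [hA] at hv
    refine hg x v fun w ↦ ?_
    have h1 := hreg.extends_g x v w
    have h2 : mfderiv (𝓡 m) (𝓡∂ m) i x v = 0 := hv
    rw [h2, map_zero] at h1
    exact h1.symm
  have hsurj : Function.Surjective A := LinearMap.injective_iff_surjective.1 hinj
  rw [hA] at hsurj
  exact hsurj

theorem potential_comp (hreg : HasRegularBoundary J g ξ i J' g' ξ') (x : M) :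
    potential g' ξ' (i x) = potential g ξ x := by
  simp only [potential, hreg.extends_field, hreg.extends_g]

theorem mem_range_or_mem_boundary (hreg : HasRegularBoundary J g ξ i J' g' ξ') (p : N) :
    p ∈ range i ∨ p ∈ (𝓡∂ m).boundary N := by
  rw [hreg.range_eq]
  exact (𝓡∂ m).isInteriorPoint_or_isBoundaryPoint p

theorem contMDiff_potential (hreg : HasRegularBoundary J g ξ i J' g' ξ') :
    ContMDiff (𝓡∂ m) 𝓘(ℝ, ℝ) ∞ (potential g' ξ') :=
  hreg.smooth_g.contMDiff_evalField hreg.smooth_field hreg.smooth_field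

theorem potential_nonneg (hreg : HasRegularBoundary J g ξ i J' g' ξ')
    (hpos : ∀ x, 0 < potential g ξ x) (p : N) : 0 ≤ potential g' ξ' p := by
  rcases hreg.mem_range_or_mem_boundary p with ⟨x, rfl⟩ | hp
  · rw [hreg.potential_comp]
    exact (hpos x).le
  · exact (hreg.potential_eq_zero p hp).ge

/-- Boundary points are limits of interior points, since the differential of the potential does not
vanish there. -/
theorem neBot_comap (hreg : HasRegularBoundary J g ξ i J' g' ξ') {p : N}
    (hp : p ∈ (𝓡∂ m).boundary N) : (comap i (𝓝 p)).NeBot := by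
  rw [comap_neBot_iff]
  intro U hU
  by_contra! hne
  apply hreg.differential_ne_zero p hp
  have h1 : potential g' ξ' =ᶠ[𝓝 p] (0 : N → ℝ) := by
    filter_upwards [hU] with y hy
    rcases hreg.mem_range_or_mem_boundary y with ⟨x, rfl⟩ | hy'
    · exact (hne x hy).elim
    · exact hreg.potential_eq_zero y hy'
  have h2 : mvfderiv (𝓡∂ m) (potential g' ξ') p = mvfderiv (𝓡∂ m) (0 : N → ℝ) p := by
    simp only [mvfderiv]
    rw [h1.mfderiv_eq]
    rfl
  rw [h2, mvfderiv_zero]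

omit [TopologicalSpace M] [ChartedSpace (EuclideanSpace ℝ (Fin m)) M] [IsManifold (𝓡∂ m) ∞ N] in
theorem eventually_mem_source (i : M → N) (p : N) :
    ∀ᶠ x in comap i (𝓝 p), i x ∈ (chartAt (EuclideanHalfSpace m) p).source :=
  tendsto_comap.eventually
    ((chartAt (EuclideanHalfSpace m) p).open_source.mem_nhds (mem_chart_source _ p))

section LimitIdentities

variable (hreg : HasRegularBoundary J g ξ i J' g' ξ')
  (hg : ∀ (x : M) (v : TangentSpace (𝓡 m) x), (∀ w, g x v w = 0) → v = 0)
  {p : N} (hp : p ∈ (𝓡∂ m).boundary N)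
include hreg hg hp

theorem endCoord_endCoord (hJ : ∀ (x : M) (v : TangentSpace (𝓡 m) x), J x (J x v) = -v)
    (e : EuclideanSpace ℝ (Fin m)) : endCoord J' p p (endCoord J' p p e) = -e := by
  have := hreg.neBot_comap hp
  have h1 : Tendsto (fun x ↦ endCoord J' p (i x)) (comap i (𝓝 p)) (𝓝 (endCoord J' p p)) :=
    (hreg.smooth_J.continuousAt_coord p).tendsto.comp tendsto_comap
  have h2 : Tendsto (fun x ↦ endCoord J' p (i x) (endCoord J' p (i x) e)) (comap i (𝓝 p))
      (𝓝 (endCoord J' p p (endCoord J' p p e))) :=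
    tendsto_clm_apply h1 (tendsto_clm_apply h1 tendsto_const_nhds)
  refine tendsto_nhds_unique_of_eventuallyEq h2 tendsto_const_nhds ?_
  filter_upwards [eventually_mem_source (m := m) i p] with x hx
  obtain ⟨v, hv⟩ := hreg.surjective_mfderiv hg x (tangentCoordSymm (𝓡∂ m) p (i x) e)
  rw [← tangentCoord_symm (I := 𝓡∂ m) hx e, ← hv, endCoord_coord J' hx, endCoord_coord J' hx, hreg.extends_J,
    hreg.extends_J, hJ, map_neg, map_neg]

theorem bilinCoord_symm (hsymm : ∀ (x : M) (v w : TangentSpace (𝓡 m) x), g x v w = g x w v)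
    (e e' : EuclideanSpace ℝ (Fin m)) : bilinCoord g' p p e e' = bilinCoord g' p p e' e := by
  have := hreg.neBot_comap hp
  have h1 : Tendsto (fun x ↦ bilinCoord g' p (i x)) (comap i (𝓝 p)) (𝓝 (bilinCoord g' p p)) :=
    (hreg.smooth_g.continuousAt_coord p).tendsto.comp tendsto_comap
  have h2 : ∀ a b : EuclideanSpace ℝ (Fin m), Tendsto (fun x ↦ bilinCoord g' p (i x) a b)
      (comap i (𝓝 p)) (𝓝 (bilinCoord g' p p a b)) := fun a b ↦
    tendsto_clm_apply (tendsto_clm_apply h1 tendsto_const_nhds) tendsto_const_nhds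
  refine tendsto_nhds_unique_of_eventuallyEq (h2 e e') (h2 e' e) ?_
  filter_upwards [eventually_mem_source (m := m) i p] with x hx
  obtain ⟨v, hv⟩ := hreg.surjective_mfderiv hg x (tangentCoordSymm (𝓡∂ m) p (i x) e)
  obtain ⟨w, hw⟩ := hreg.surjective_mfderiv hg x (tangentCoordSymm (𝓡∂ m) p (i x) e')
  rw [bilinCoord_apply g' hx, bilinCoord_apply g' hx, ← hv, ← hw, hreg.extends_g, hreg.extends_g,
    hsymm]

theorem mvfderiv_potential_boundary
    (hdf : ∀ (x : M) (v : TangentSpace (𝓡 m) x),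
      mvfderiv (𝓡 m) (potential g ξ) x v = 2 * g x (ξ x) v)
    (e : EuclideanSpace ℝ (Fin m)) :
    mvfderiv (𝓡∂ m) (potential g' ξ') p e
      = 2 * bilinCoord g' p p (tangentCoord (𝓡∂ m) p p (ξ' p)) e := by
  have := hreg.neBot_comap hp
  have h1 : Tendsto (fun x ↦ bilinCoord g' p (i x)) (comap i (𝓝 p)) (𝓝 (bilinCoord g' p p)) :=
    (hreg.smooth_g.continuousAt_coord p).tendsto.comp tendsto_comap
  have h2 : Tendsto (fun x ↦ tangentCoord (𝓡∂ m) p (i x) (ξ' (i x))) (comap i (𝓝 p))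
      (𝓝 (tangentCoord (𝓡∂ m) p p (ξ' p))) :=
    (hreg.smooth_field.continuousAt_coord p).tendsto.comp tendsto_comap
  have h3 : Tendsto (fun x ↦ (mvfderiv (𝓡∂ m) (potential g' ξ') (i x)).comp
      (tangentCoordSymm (𝓡∂ m) p (i x))) (comap i (𝓝 p))
      (𝓝 ((mvfderiv (𝓡∂ m) (potential g' ξ') p).comp (tangentCoordSymm (𝓡∂ m) p p))) :=
    (continuousAt_mvfderiv_coord hreg.contMDiff_potential p).tendsto.comp tendsto_comap
  have h4 := tendsto_clm_apply h3 (tendsto_const_nhds (x := e))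
  have h5 := (tendsto_clm_apply (tendsto_clm_apply h1 h2) (tendsto_const_nhds (x := e))).const_mul 2
  have h6 := tendsto_nhds_unique_of_eventuallyEq h4 h5 ?_
  · rw [← h6, ContinuousLinearMap.comp_apply, tangentCoordSymm_self]
  · filter_upwards [eventually_mem_source (m := m) i p] with x hx
    obtain ⟨v, hv⟩ := hreg.surjective_mfderiv hg x (tangentCoordSymm (𝓡∂ m) p (i x) e)
    have h7 : potential g' ξ' ∘ i = potential g ξ := funext hreg.potential_comp
    have h8 := mvfderiv_comp_apply x (hreg.contMDiff_potential.mdifferentiable (by simp) (i x))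
      (hreg.mdifferentiableAt_embedding x) v
    rw [h7, hdf] at h8
    rw [ContinuousLinearMap.comp_apply, bilinCoord_apply g' hx, tangentCoordSymm_coord hx, ← hv,
      ← h8, hreg.extends_field, hreg.extends_g]

/-- At a boundary point, `g'` is negative on the vectors orthogonal, in coordinates, to `ξ'` and
`J' ξ'` which are annihilated by `α` and `J^* α`. -/
theorem bilinCoord_neg (hpos : ∀ x, 0 < potential g ξ x)
    (hJ : ∀ (x : M) (v : TangentSpace (𝓡 m) x), J x (J x v) = -v)
    (hsymm : ∀ (x : M) (v w : TangentSpace (𝓡 m) x), g x v w = g x w v)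
    (hdf : ∀ (x : M) (v : TangentSpace (𝓡 m) x),
      mvfderiv (𝓡 m) (potential g ξ) x v = 2 * g x (ξ x) v)
    {e : EuclideanSpace ℝ (Fin m)} (he : e ≠ 0)
    (he1 : inner ℝ (tangentCoord (𝓡∂ m) p p (ξ' p)) e = 0)
    (he2 : inner ℝ (endCoord J' p p (tangentCoord (𝓡∂ m) p p (ξ' p))) e = 0)
    (he3 : bilinCoord g' p p (tangentCoord (𝓡∂ m) p p (ξ' p)) e = 0)
    (he4 : bilinCoord g' p p (tangentCoord (𝓡∂ m) p p (ξ' p)) (endCoord J' p p e) = 0) :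
    bilinCoord g' p p e e < 0 := by
  have hps := mem_chart_source (EuclideanHalfSpace m) p
  obtain ⟨A, hA⟩ : ∃ A : EuclideanSpace ℝ (Fin m) →L[ℝ] ℝ,
    A = mvfderiv (𝓡∂ m) (potential g' ξ') p := ⟨_, rfl⟩
  have hA0 : ∀ a : EuclideanSpace ℝ (Fin m), a 0 = 0 → A a = 0 := fun a ha ↦ by
    rw [hA]
    exact mvfderiv_eq_zero_of_nonneg (hreg.contMDiff_potential.mdifferentiable (by simp) p) hp
      (hreg.potential_nonneg hpos) (hreg.potential_eq_zero p hp) ha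
  have hA1 : ∀ a : EuclideanSpace ℝ (Fin m), A a
      = 2 * bilinCoord g' p p (tangentCoord (𝓡∂ m) p p (ξ' p)) a := fun a ↦ by
    rw [hA]
    exact hreg.mvfderiv_potential_boundary hg hp hdf a
  have hA2 : A ≠ 0 := by
    rw [hA]
    exact hreg.differential_ne_zero p hp
  let u : EuclideanSpace ℝ (Fin m) := EuclideanSpace.single 0 1
  have hdec : ∀ a : EuclideanSpace ℝ (Fin m), A a = a 0 * A u := fun a ↦ by
    have h1 := hA0 (a - a 0 • u) (by simp [u])
    rw [map_sub, map_smul, smul_eq_mul] at h1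
    linarith
  have hu : A u ≠ 0 := fun h ↦ hA2 (by
    ext a
    rw [hdec, h, mul_zero]
    rfl)
  have hker : ∀ a : EuclideanSpace ℝ (Fin m),
      bilinCoord g' p p (tangentCoord (𝓡∂ m) p p (ξ' p)) a = 0 → a 0 = 0 := fun a ha ↦ by
    have h1 := hA1 a
    rw [ha, mul_zero, hdec] at h1
    exact (mul_eq_zero.1 h1).resolve_right hu
  have hbd : ∀ a : EuclideanSpace ℝ (Fin m), a 0 = 0 →
      tangentCoordSymm (𝓡∂ m) p p a ∈ boundaryTangent p := fun a ha ↦ by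
    have h1 := tangentCoord_eq_mfderiv hps (tangentCoordSymm (𝓡∂ m) p p a)
    rw [tangentCoord_symm hps] at h1
    change (show EuclideanSpace ℝ (Fin m) from _) 0 = 0
    rw [← ha]
    exact (congrArg (fun b : EuclideanSpace ℝ (Fin m) ↦ b 0) h1).symm
  set v := tangentCoordSymm (𝓡∂ m) p p e with hv
  have hJe : tangentCoordSymm (𝓡∂ m) p p (endCoord J' p p e) = J' p v := by
    rw [endCoord_apply, tangentCoordSymm_coord hps]
  have hJJ : J' p (J' p v) = -v := by
    have h1 := hreg.endCoord_endCoord hg hp hJ e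
    rw [endCoord_apply, hJe] at h1
    have h2 := congrArg (tangentCoordSymm (𝓡∂ m) p p) h1
    rwa [tangentCoordSymm_coord hps, map_neg] at h2
  have hvH : v ∈ complexBoundaryTangent J' p := by
    refine ⟨hbd e (hker e he3), -J' p v, neg_mem ?_, ?_⟩
    · rw [← hJe]
      exact hbd _ (hker _ he4)
    · change J' p (-J' p v) = v
      rw [map_neg, hJJ, neg_neg]
  have hgv : bilinCoord g' p p e e = g' p v v := bilinCoord_apply g' hps e e
  rw [hgv]
  refine (hreg.semidefinite p hp v hvH).lt_of_ne fun hzero ↦ ?_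
  have hsymm' : ∀ a b : TangentSpace (𝓡∂ m) p, g' p a b = g' p b a := fun a b ↦ by
    have h1 := bilinCoord_coord g' hps a b
    have h2 := bilinCoord_coord g' hps b a
    rw [← h1, ← h2]
    exact hreg.bilinCoord_symm hg hp hsymm _ _
  have hmem : v ∈ distr J' ξ' p := by
    refine (hreg.kernel p hp v).1 ⟨hvH, fun w hw ↦ ?_⟩
    refine eq_zero_of_semidefinite_of_self_eq_zero (b := fun a b ↦ g' p a b) ?_ ?_ hsymm'
      _ (hreg.semidefinite p hp) hvH hzero hw
    · intro a b c d
      simp only [map_add, add_apply]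
      ring
    · intro s t a b
      simp only [map_smul, smul_apply, smul_eq_mul]
      ring
  obtain ⟨s, t, hst⟩ := Submodule.mem_span_pair.1 hmem
  have hest : e = s • tangentCoord (𝓡∂ m) p p (ξ' p)
      + t • endCoord J' p p (tangentCoord (𝓡∂ m) p p (ξ' p)) := by
    rw [← tangentCoord_symm (I := 𝓡∂ m) hps e, ← hv, ← hst, map_add, map_smul, map_smul, endCoord_coord J' hps]
  apply he
  rw [← inner_self_eq_zero (𝕜 := ℝ)]
  nth_rewrite 1 [hest]
  rw [inner_add_left, inner_smul_left, inner_smul_left, he1, he2]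
  simp

end LimitIdentities

end HasRegularBoundary

end BoundaryEstimate

section Differentials

variable {E : Type*} [NormedAddCommGroup E] [NormedSpace ℝ E]
  {H : Type*} [TopologicalSpace H] {I : ModelWithCorners ℝ E H}
  {M : Type*} [TopologicalSpace M] [ChartedSpace H M]
  {F₁ : Type*} [NormedAddCommGroup F₁] [NormedSpace ℝ F₁]
  {F₂ : Type*} [NormedAddCommGroup F₂] [NormedSpace ℝ F₂]

theorem hasMFDerivAt_iff_mvfderiv {f : M → F₁} {x : M} {A : E →L[ℝ] F₁} :
    HasMFDerivAt I 𝓘(ℝ, F₁) f x A ↔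
      MDifferentiableAt I 𝓘(ℝ, F₁) f x ∧ ∀ v : TangentSpace I x, mvfderiv I f x v = A v := by
  constructor
  · intro h
    refine ⟨h.mdifferentiableAt, fun v ↦ ?_⟩
    exact DFunLike.congr_fun h.mfderiv v
  · rintro ⟨h1, h2⟩
    have h3 := h1.hasMFDerivAt
    have h4 : mfderiv I 𝓘(ℝ, F₁) f x = A := ContinuousLinearMap.ext h2
    rwa [h4] at h3

theorem mvfderiv_prodMk {a : M → F₁} {b : M → F₂} {x : M}
    (ha : MDifferentiableAt I 𝓘(ℝ, F₁) a x) (hb : MDifferentiableAt I 𝓘(ℝ, F₂) b x) :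
    MDifferentiableAt I 𝓘(ℝ, F₁ × F₂) (fun y ↦ (a y, b y)) x ∧
      ∀ v : TangentSpace I x,
        mvfderiv I (fun y ↦ (a y, b y)) x v = (mvfderiv I a x v, mvfderiv I b x v) := by
  obtain ⟨A, hA⟩ : ∃ A : E →L[ℝ] F₁, A = mfderiv I 𝓘(ℝ, F₁) a x := ⟨_, rfl⟩
  obtain ⟨B, hB⟩ : ∃ B : E →L[ℝ] F₂, B = mfderiv I 𝓘(ℝ, F₂) b x := ⟨_, rfl⟩
  have h1 : HasMFDerivAt I 𝓘(ℝ, F₁) a x A := by rw [hA]; exact ha.hasMFDerivAt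
  have h2 : HasMFDerivAt I 𝓘(ℝ, F₂) b x B := by rw [hB]; exact hb.hasMFDerivAt
  have h3 : HasMFDerivAt I 𝓘(ℝ, F₁ × F₂) (fun y ↦ (a y, b y)) x (A.prod B) :=
    ⟨h1.1.prodMk h2.1, HasFDerivWithinAt.prodMk h1.2 h2.2⟩
  rw [hasMFDerivAt_iff_mvfderiv] at h1 h2 h3
  refine ⟨h3.1, fun v ↦ ?_⟩
  rw [h1.2, h2.2, h3.2]
  rfl

theorem mvfderiv_log {f : M → ℝ} {x : M} (hf : MDifferentiableAt I 𝓘(ℝ, ℝ) f x) (hx : f x ≠ 0) :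
    MDifferentiableAt I 𝓘(ℝ, ℝ) (fun y ↦ Real.log (f y)) x ∧
      ∀ v : TangentSpace I x,
        mvfderiv I (fun y ↦ Real.log (f y)) x v = mvfderiv I f x v / f x := by
  have h1 := (Real.hasDerivAt_log hx).hasFDerivAt.hasMFDerivAt.comp x hf.hasMFDerivAt
  have h2 := hasMFDerivAt_iff_mvfderiv.1 h1
  refine ⟨h2.1, fun v ↦ (h2.2 v).trans ?_⟩
  rw [div_eq_mul_inv]
  rfl

end Differentials

section BoundaryEstimate

variable {m : ℕ} [NeZero m]
  {M : Type*} [TopologicalSpace M] [ChartedSpace (EuclideanSpace ℝ (Fin m)) M]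
  {N : Type*} [TopologicalSpace N] [ChartedSpace (EuclideanHalfSpace m) N] [IsManifold (𝓡∂ m) ∞ N]
  {J : EndField (𝓡 m) M} {g : BilinField (𝓡 m) M} {ξ : VField (𝓡 m) M}
  {i : M → N} {J' : EndField (𝓡∂ m) N} {g' : BilinField (𝓡∂ m) N} {ξ' : VField (𝓡∂ m) N}

/-- Near a boundary point every tangent vector can be corrected by a combination of `ξ` and `J ξ`
so that its coordinates and its logarithmic derivative of the potential are controlled by the
horizontal form. -/
theorem HasRegularBoundary.exists_bound_horizontalForm
    (hreg : HasRegularBoundary J g ξ i J' g' ξ')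
    (hg : ∀ (x : M) (v : TangentSpace (𝓡 m) x), (∀ w, g x v w = 0) → v = 0)
    (hpos : ∀ x, 0 < potential g ξ x)
    (hJ : ∀ (x : M) (v : TangentSpace (𝓡 m) x), J x (J x v) = -v)
    (hsymm : ∀ (x : M) (v w : TangentSpace (𝓡 m) x), g x v w = g x w v)
    (hdf : ∀ (x : M) (v : TangentSpace (𝓡 m) x),
      mvfderiv (𝓡 m) (potential g ξ) x v = 2 * g x (ξ x) v)
    {p : N} (hp : p ∈ (𝓡∂ m).boundary N) :
    ∃ C : ℝ, 0 < C ∧ ∀ᶠ x in comap i (𝓝 p), ∀ v : TangentSpace (𝓡 m) x, ∃ s t : ℝ,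
      ‖tangentCoord (𝓡∂ m) p (i x)
        (mfderiv (𝓡 m) (𝓡∂ m) i x (v - (s • ξ x + t • J x (ξ x))))‖ ^ 2
          ≤ C * horizontalForm J g ξ x (v - (s • ξ x + t • J x (ξ x)))
            (v - (s • ξ x + t • J x (ξ x))) ∧
      (g x (ξ x) (v - (s • ξ x + t • J x (ξ x))) / potential g ξ x) ^ 2
          ≤ C * horizontalForm J g ξ x (v - (s • ξ x + t • J x (ξ x)))
            (v - (s • ξ x + t • J x (ξ x))) := by
  have hi : Tendsto i (comap i (𝓝 p)) (𝓝 p) := tendsto_comap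
  have hG : Tendsto (fun x ↦ bilinCoord g' p (i x)) (comap i (𝓝 p)) (𝓝 (bilinCoord g' p p)) :=
    (hreg.smooth_g.continuousAt_coord p).tendsto.comp hi
  have hX : Tendsto (fun x ↦ tangentCoord (𝓡∂ m) p (i x) (ξ' (i x))) (comap i (𝓝 p))
      (𝓝 (tangentCoord (𝓡∂ m) p p (ξ' p))) :=
    (hreg.smooth_field.continuousAt_coord p).tendsto.comp hi
  have hE : Tendsto (fun x ↦ endCoord J' p (i x)) (comap i (𝓝 p)) (𝓝 (endCoord J' p p)) :=
    (hreg.smooth_J.continuousAt_coord p).tendsto.comp hi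
  have hY := tendsto_clm_apply hE hX
  have hα := tendsto_clm_apply hG hX
  have hβ : Tendsto (fun x ↦ (bilinCoord g' p (i x) (tangentCoord (𝓡∂ m) p (i x) (ξ' (i x)))).comp
      (endCoord J' p (i x))) (comap i (𝓝 p))
      (𝓝 ((bilinCoord g' p p (tangentCoord (𝓡∂ m) p p (ξ' p))).comp (endCoord J' p p))) :=
    (isBoundedBilinearMap_comp.continuous.tendsto (bilinCoord g' p p
      (tangentCoord (𝓡∂ m) p p (ξ' p)), endCoord J' p p)).comp (hα.prodMk_nhds hE)
  have hf : Tendsto (potential g ξ) (comap i (𝓝 p)) (𝓝 0) := by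
    have h1 : Tendsto (fun x ↦ potential g' ξ' (i x)) (comap i (𝓝 p)) (𝓝 (potential g' ξ' p)) :=
      (hreg.contMDiff_potential.continuous.tendsto p).comp hi
    rw [hreg.potential_eq_zero p hp] at h1
    simpa only [hreg.potential_comp] using h1
  obtain ⟨C, hC, hev⟩ := exists_eventually_sq_norm_le_and_sq_div_le hG hX hY hα hβ hf
    (Eventually.of_forall hpos) (fun e he h1 h2 h3 h4 ↦
      hreg.bilinCoord_neg hg hp hpos hJ hsymm hdf he h1 h2 h3 h4)
  refine ⟨C, hC, ?_⟩
  filter_upwards [hev, HasRegularBoundary.eventually_mem_source (m := m) i p] with x hx hxs v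
  set X := tangentCoord (𝓡∂ m) p (i x) (ξ' (i x)) with hXdef
  set Y := endCoord J' p (i x) X with hYdef
  set e := tangentCoord (𝓡∂ m) p (i x) (mfderiv (𝓡 m) (𝓡∂ m) i x v) with he
  obtain ⟨y, hy, z, hz, hyz⟩ := (Submodule.span ℝ {X, Y}).exists_add_mem_mem_orthogonal e
  obtain ⟨s, t, hst⟩ := Submodule.mem_span_pair.1 hy
  refine ⟨s, t, ?_⟩
  set v' : TangentSpace (𝓡 m) x := v - (s • ξ x + t • J x (ξ x)) with hv'
  have hξX : tangentCoord (𝓡∂ m) p (i x) (mfderiv (𝓡 m) (𝓡∂ m) i x (ξ x)) = X := by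
    rw [← hreg.extends_field]
  have hcoord : tangentCoord (𝓡∂ m) p (i x) (mfderiv (𝓡 m) (𝓡∂ m) i x v') = z := by
    rw [hv', map_sub, map_add, map_smul, map_smul, ← hreg.extends_J, ← hreg.extends_field, map_sub,
      map_add, map_smul, map_smul, ← endCoord_coord J' hxs, ← hXdef, ← hYdef, hst, ← he, hyz,
      add_sub_cancel_left]
  have hJz : endCoord J' p (i x) z
      = tangentCoord (𝓡∂ m) p (i x) (mfderiv (𝓡 m) (𝓡∂ m) i x (J x v')) := by
    rw [← hcoord, endCoord_coord J' hxs, hreg.extends_J]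
  have h1 : bilinCoord g' p (i x) z z = g x v' v' := by
    rw [← hcoord, bilinCoord_coord g' hxs, hreg.extends_g]
  have h2 : bilinCoord g' p (i x) X z = g x (ξ x) v' := by
    rw [← hcoord, ← hξX, bilinCoord_coord g' hxs, hreg.extends_g]
  have h3 : bilinCoord g' p (i x) X (endCoord J' p (i x) z) = g x (ξ x) (J x v') := by
    rw [hJz, ← hξX, bilinCoord_coord g' hxs, hreg.extends_g]
  have h4 := hx z (Submodule.inner_right_of_mem_orthogonal (Submodule.subset_span (by simp)) hz)
    (Submodule.inner_right_of_mem_orthogonal (Submodule.subset_span (by simp)) hz)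
  simp only [ContinuousLinearMap.comp_apply, h1, h2, h3] at h4
  rw [hcoord]
  have h5 : horizontalForm J g ξ x v' v' = -(g x v' v') / potential g ξ x
      + (g x (ξ x) v' ^ 2 + g x (ξ x) (J x v') ^ 2) / potential g ξ x ^ 2 := by
    simp only [horizontalForm]
    ring
  rw [h5]
  exact h4

end BoundaryEstimate

section HorizontalForm

variable {E : Type*} [NormedAddCommGroup E] [NormedSpace ℝ E]
  {H : Type*} [TopologicalSpace H] {I : ModelWithCorners ℝ E H}
  {M : Type*} [TopologicalSpace M] [ChartedSpace H M]
  {J : EndField I M} {g : BilinField I M} {ξ : VField I M}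

theorem metric_apply_J_self {x : M} (hJ : ∀ v : TangentSpace I x, J x (J x v) = -v)
    (hsymm : ∀ v w : TangentSpace I x, g x v w = g x w v)
    (hherm : ∀ v w : TangentSpace I x, g x (J x v) (J x w) = g x v w) (v : TangentSpace I x) :
    g x v (J x v) = 0 := by
  have h1 := hherm v (J x v)
  rw [hJ, map_neg, hsymm (J x v) v] at h1
  linarith

theorem horizontalForm_field {x : M} (hJ : ∀ v : TangentSpace I x, J x (J x v) = -v)
    (hsymm : ∀ v w : TangentSpace I x, g x v w = g x w v)
    (hherm : ∀ v w : TangentSpace I x, g x (J x v) (J x w) = g x v w)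
    (hpos : 0 < potential g ξ x) : horizontalForm J g ξ x (ξ x) (ξ x) = 0 := by
  have h1 : g x (ξ x) (ξ x) = potential g ξ x := rfl
  simp only [horizontalForm, metric_apply_J_self hJ hsymm hherm, h1]
  field_simp
  ring

theorem horizontalForm_J_field {x : M} (hJ : ∀ v : TangentSpace I x, J x (J x v) = -v)
    (hsymm : ∀ v w : TangentSpace I x, g x v w = g x w v)
    (hherm : ∀ v w : TangentSpace I x, g x (J x v) (J x w) = g x v w)
    (hpos : 0 < potential g ξ x) : horizontalForm J g ξ x (J x (ξ x)) (J x (ξ x)) = 0 := by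
  have h1 : g x (ξ x) (ξ x) = potential g ξ x := rfl
  simp only [horizontalForm, metric_apply_J_self hJ hsymm hherm, hherm, hJ, map_neg, h1]
  field_simp
  ring

end HorizontalForm

section LocalCompactness

variable {m : ℕ} [NeZero m]
  {M : Type*} [TopologicalSpace M] [T2Space M] [ChartedSpace (EuclideanSpace ℝ (Fin m)) M]
  [IsManifold (𝓡 m) ∞ M]
  {N : Type*} [TopologicalSpace N] [ChartedSpace (EuclideanHalfSpace m) N]
  [IsManifold (𝓡∂ m) ∞ N]
  {J : EndField (𝓡 m) M} {g : BilinField (𝓡 m) M} {ξ : VField (𝓡 m) M}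
  {i : M → N} {J' : EndField (𝓡∂ m) N} {g' : BilinField (𝓡∂ m) N} {ξ' : VField (𝓡∂ m) N}
  {k : ℕ} {B : Type*} [TopologicalSpace B] [T2Space B]
  [ChartedSpace (EuclideanSpace ℝ (Fin k)) B] [IsManifold (𝓡 k) ∞ B]
  [RiemannianBundle (fun x : B ↦ TangentSpace (𝓡 k) x)]
  [IsContinuousRiemannianBundle (EuclideanSpace ℝ (Fin k)) (fun x : B ↦ TangentSpace (𝓡 k) x)]
  {pr : M → B}

omit [T2Space M] [IsManifold (𝓡 m) ∞ M] in
theorem HasRegularBoundary.isCompact_preimage (hreg : HasRegularBoundary J g ξ i J' g' ξ')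
    {K : Set N} (hK : IsCompact K) {c : ℝ} (hc : 0 < c) :
    IsCompact (i ⁻¹' (K ∩ {y | c ≤ potential g' ξ' y})) := by
  refine (hreg.embedding.isEmbedding.isInducing.isCompact_preimage_iff ?_).2
    (hK.inter_right (isClosed_le continuous_const hreg.contMDiff_potential.continuous))
  rintro y ⟨-, hy⟩
  refine (hreg.mem_range_or_mem_boundary y).resolve_right fun hy' ↦ ?_
  rw [mem_ofPred_eq, hreg.potential_eq_zero y hy'] at hy
  exact hc.not_ge hy

/-- Near a boundary point of the compactification, balls of a uniform radius in the base are
contained in compact sets. -/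
theorem HasRegularBoundary.exists_compact_of_mem_boundary
    (hreg : HasRegularBoundary J g ξ i J' g' ξ')
    (hg : ∀ (x : M) (v : TangentSpace (𝓡 m) x), (∀ w, g x v w = 0) → v = 0)
    (hpos : ∀ x, 0 < potential g ξ x)
    (hJ : ∀ (x : M) (v : TangentSpace (𝓡 m) x), J x (J x v) = -v)
    (hsymm : ∀ (x : M) (v w : TangentSpace (𝓡 m) x), g x v w = g x w v)
    (hherm : ∀ (x : M) (v w : TangentSpace (𝓡 m) x), g x (J x v) (J x w) = g x v w)
    (hdf : ∀ (x : M) (v : TangentSpace (𝓡 m) x),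
      mvfderiv (𝓡 m) (potential g ξ) x v = 2 * g x (ξ x) v)
    (hpr : ContMDiff (𝓡 m) (𝓡 k) 1 pr)
    (hsurj : ∀ x, Function.Surjective (mfderiv (𝓡 m) (𝓡 k) pr x))
    (hnorm : ∀ (x : M) (v : TangentSpace (𝓡 m) x),
      ‖mfderiv (𝓡 m) (𝓡 k) pr x v‖ ^ 2 = horizontalForm J g ξ x v v)
    {p : N} (hp : p ∈ (𝓡∂ m).boundary N) :
    ∃ δ > 0, ∃ V ∈ 𝓝 p, ∀ x, i x ∈ V →
      ∃ K : Set B, IsCompact K ∧ ∀ b, riemannianEDist (𝓡 k) (pr x) b < δ → b ∈ K := by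
  obtain ⟨C, hC, hev⟩ := hreg.exists_bound_horizontalForm hg hpos hJ hsymm hdf hp
  rw [eventually_comap] at hev
  obtain ⟨W, hW, hWo, hpW⟩ := eventually_nhds_iff.1
    (hev.and ((chartAt (EuclideanHalfSpace m) p).open_source.mem_nhds (mem_chart_source _ p)))
  have : LocallyCompactSpace N := Manifold.locallyCompact_of_finiteDimensional (𝓡∂ m)
  obtain ⟨K₀, hK₀, hK₀W, hK₀c⟩ := local_compact_nhds (hWo.mem_nhds hpW)
  let φ := extChartAt (𝓡∂ m) p
  obtain ⟨ρ, hρ, hρK⟩ := Metric.mem_nhds_iff.1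
    ((continuousAt_extChartAt_symm p).preimage_mem_nhds
      (by rw [extChartAt_to_inv]; exact hK₀ : K₀ ∈ 𝓝 (φ.symm (φ p))))
  have hφK : ∀ y ∈ W, ‖φ y - φ p‖ < ρ → y ∈ K₀ := fun y hy hyρ ↦ by
    have h1 : φ.symm (φ y) ∈ K₀ := hρK (mem_ball_iff_norm.2 hyρ)
    have h2 : φ.symm (φ y) = y := φ.left_inv (by rw [extChartAt_source]; exact (hW y hy).2)
    rwa [h2] at h1
  let U : Set M := i ⁻¹' W
  have hU : IsOpen U := hWo.preimage hreg.embedding.isEmbedding.continuous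
  let Ψ : M → EuclideanSpace ℝ (Fin m) × ℝ := fun x ↦ (φ (i x), Real.log (potential g ξ x))
  have hfd : ∀ x, MDifferentiableAt (𝓡 m) 𝓘(ℝ, ℝ) (potential g ξ) x := fun x ↦ by
    have h1 : potential g' ξ' ∘ i = potential g ξ := funext hreg.potential_comp
    rw [← h1]
    exact (hreg.contMDiff_potential.mdifferentiable (by simp) (i x)).comp x
      (hreg.mdifferentiableAt_embedding x)
  have hφd : ∀ x ∈ U, MDifferentiableAt (𝓡 m) 𝓘(ℝ, EuclideanSpace ℝ (Fin m)) (φ ∘ i) x :=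
    fun x hx ↦ (mdifferentiableAt_extChartAt (hW _ hx).2).comp x (hreg.mdifferentiableAt_embedding x)
  have hΨ : ∀ x ∈ U, MDifferentiableAt (𝓡 m) 𝓘(ℝ, EuclideanSpace ℝ (Fin m) × ℝ) Ψ x ∧
      ∀ v : TangentSpace (𝓡 m) x, mvfderiv (𝓡 m) Ψ x v
        = (tangentCoord (𝓡∂ m) p (i x) (mfderiv (𝓡 m) (𝓡∂ m) i x v),
          2 * (g x (ξ x) v / potential g ξ x)) := fun x hx ↦ by
    have h1 := mvfderiv_log (hfd x) (hpos x).ne'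
    have h2 := mvfderiv_prodMk (hφd x hx) h1.1
    refine ⟨h2.1, fun v ↦ (h2.2 v).trans ?_⟩
    rw [h1.2, hdf, mul_div_assoc]
    congr 1
    rw [tangentCoord_eq_mfderiv (hW _ hx).2]
    exact mfderiv_comp_apply x (mdifferentiableAt_extChartAt (hW _ hx).2)
      (hreg.mdifferentiableAt_embedding x) v
  have hvert : ∀ (x : M) (s t : ℝ),
      mfderiv (𝓡 m) (𝓡 k) pr x (s • ξ x + t • J x (ξ x)) = 0 := fun x s t ↦ by
    have h1 : mfderiv (𝓡 m) (𝓡 k) pr x (ξ x) = 0 := by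
      rw [← norm_eq_zero, ← sq_eq_zero_iff, hnorm,
        horizontalForm_field (hJ x) (hsymm x) (hherm x) (hpos x)]
    have h2 : mfderiv (𝓡 m) (𝓡 k) pr x (J x (ξ x)) = 0 := by
      rw [← norm_eq_zero, ← sq_eq_zero_iff, hnorm,
        horizontalForm_J_field (hJ x) (hsymm x) (hherm x) (hpos x)]
    rw [map_add, map_smul, map_smul, h1, h2, smul_zero, smul_zero, add_zero]
  let C' := 2 * Real.sqrt C
  have hC' : 0 < C' := by positivity
  have hctrl : ∀ x ∈ U, ∀ w : TangentSpace (𝓡 k) (pr x), ∃ v : TangentSpace (𝓡 m) x,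
      mfderiv (𝓡 m) (𝓡 k) pr x v = w ∧ ‖mvfderiv (𝓡 m) Ψ x v‖ ≤ C' * ‖w‖ := fun x hx w ↦ by
    obtain ⟨v, rfl⟩ := hsurj x w
    obtain ⟨s, t, h1, h2⟩ := (hW _ hx).1 x rfl v
    have h3 : mfderiv (𝓡 m) (𝓡 k) pr x (v - (s • ξ x + t • J x (ξ x)))
        = mfderiv (𝓡 m) (𝓡 k) pr x v := by rw [map_sub, hvert, sub_zero]
    refine ⟨_, h3, ?_⟩
    rw [← hnorm, h3] at h1 h2
    have h4 : C * ‖mfderiv (𝓡 m) (𝓡 k) pr x v‖ ^ 2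
        = (Real.sqrt C * ‖mfderiv (𝓡 m) (𝓡 k) pr x v‖) ^ 2 := by
      rw [mul_pow, Real.sq_sqrt hC.le]
    rw [h4] at h1 h2
    have h5 := abs_le_of_sq_le_sq h1 (by positivity)
    have h6 := abs_le_of_sq_le_sq h2 (by positivity)
    have h7 : 0 ≤ Real.sqrt C * ‖mfderiv (𝓡 m) (𝓡 k) pr x v‖ := by positivity
    rw [(hΨ x hx).2, Prod.norm_def]
    refine max_le ?_ ?_
    · simp only [C']
      linarith [(le_abs_self _).trans h5]
    · simp only [Real.norm_eq_abs, abs_mul, abs_two, C']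
      linarith
  let r := ρ / 4
  refine ⟨ENNReal.ofReal (r / C'), by simp [r]; positivity, W ∩ {y | ‖φ y - φ p‖ < ρ / 2},
    inter_mem (hWo.mem_nhds hpW) ?_, ?_⟩
  · have h1 : ContinuousAt (fun y ↦ ‖φ y - φ p‖) p :=
      ((continuousAt_extChartAt p).sub continuousAt_const).norm
    exact h1.eventually (gt_mem_nhds (by simpa [φ] using by positivity))
  · rintro x₀ ⟨hx₀W, hx₀ρ⟩
    let c := Real.exp (-r) * potential g ξ x₀
    have hc : 0 < c := mul_pos (Real.exp_pos _) (hpos x₀)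
    let K : Set M := i ⁻¹' (K₀ ∩ {y | c ≤ potential g' ξ' y})
    have hK : IsCompact K := hreg.isCompact_preimage hK₀c hc
    refine ⟨pr '' K, hK.image hpr.continuous, fun b hb ↦ ?_⟩
    have hxK : ∀ x ∈ U, ‖Ψ x - Ψ x₀‖ ≤ r → x ∈ K := fun x hx hxr ↦ by
      have h1 : ‖φ (i x) - φ (i x₀)‖ ≤ r := (norm_fst_le (Ψ x - Ψ x₀)).trans hxr
      have h2 : ‖Real.log (potential g ξ x) - Real.log (potential g ξ x₀)‖ ≤ r :=
        (norm_snd_le (Ψ x - Ψ x₀)).trans hxr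
      refine ⟨hφK _ hx ?_, ?_⟩
      · have h3 := norm_sub_le_norm_sub_add_norm_sub (φ (i x)) (φ (i x₀)) (φ p)
        have h4 : ‖φ (i x₀) - φ p‖ < ρ / 2 := hx₀ρ
        simp only [r] at h1
        linarith
      · rw [mem_ofPred_eq, hreg.potential_comp]
        have h3 := (abs_le.1 h2).1
        rw [← Real.exp_log (hpos x)]
        have h4 : c = Real.exp (-r + Real.log (potential g ξ x₀)) := by
          rw [Real.exp_add, Real.exp_log (hpos x₀)]
        rw [h4]
        exact Real.exp_le_exp.2 (by linarith)
    obtain ⟨γ, hγ0, hγ1, hγ, hlen, -⟩ :=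
      exists_lt_locally_constant_of_riemannianEDist_lt hb zero_lt_one
    obtain ⟨x, hx, hxb⟩ := exists_mem_fibre_of_pathELength_lt (U := U) hpr hsurj hU hK
      (fun x hx ↦ hK₀W hx.1) (fun x hx ↦ (hΨ x hx).1) hC' hctrl hx₀W (r := r) hxK hγ hγ0 hlen
    exact ⟨x, hx, hxb.trans hγ1⟩

end LocalCompactness

section Interior

variable {k : ℕ} {B : Type*} [TopologicalSpace B] [T2Space B]
  [ChartedSpace (EuclideanSpace ℝ (Fin k)) B] [IsManifold (𝓡 k) ∞ B]
  [RiemannianBundle (fun x : B ↦ TangentSpace (𝓡 k) x)]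
  [IsContinuousRiemannianBundle (EuclideanSpace ℝ (Fin k)) (fun x : B ↦ TangentSpace (𝓡 k) x)]

theorem exists_compact_of_riemannianEDist_lt (b₀ : B) :
    ∃ δ > 0, ∃ V ∈ 𝓝 b₀, ∀ b ∈ V,
      ∃ K : Set B, IsCompact K ∧ ∀ b', riemannianEDist (𝓡 k) b b' < δ → b' ∈ K := by
  have : LocallyCompactSpace B := Manifold.locallyCompact_of_finiteDimensional (𝓡 k)
  obtain ⟨K, hK, hK₀⟩ := exists_compact_mem_nhds b₀
  obtain ⟨c, hc, hcK⟩ := setOfPred_riemannianEDist_lt_subset_nhds' (𝓡 k) hK₀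
  have hc2 : 0 < c / 2 := ENNReal.half_pos hc.ne'
  refine ⟨c / 2, hc2, _, eventually_riemannianEDist_lt (𝓡 k) b₀ hc2,
    fun b hb ↦ ⟨K, hK, fun b' hb' ↦ hcK ?_⟩⟩
  calc riemannianEDist (𝓡 k) b₀ b'
      ≤ riemannianEDist (𝓡 k) b₀ b + riemannianEDist (𝓡 k) b b' := riemannianEDist_triangle
    _ < c / 2 + c / 2 := ENNReal.add_lt_add hb hb'
    _ = c := ENNReal.add_halves c

omit [T2Space B] [IsManifold (𝓡 k) ∞ B]
  [IsContinuousRiemannianBundle (EuclideanSpace ℝ (Fin k)) (fun x : B ↦ TangentSpace (𝓡 k) x)] in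
theorem eq_of_riemannianEDist_lt_top (hk : k = 0) {b b' : B}
    (h : riemannianEDist (𝓡 k) b b' < ⊤) : b' = b := by
  subst hk
  have : DiscreteTopology B := ChartedSpace.discreteTopology (EuclideanSpace ℝ (Fin 0)) B
  obtain ⟨γ, hγ0, hγ1, hγ, -⟩ := exists_lt_locally_constant_of_riemannianEDist_lt h zero_lt_one
  rw [← hγ0, ← hγ1]
  exact PreconnectedSpace.constant inferInstance hγ.continuous

end Interior

section Projective

variable {n : ℕ}
  {M : Type*} [TopologicalSpace M] [ChartedSpace (EuclideanSpace ℝ (Fin (2 * (n + 1)))) M]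
  [IsManifold (𝓡 (2 * (n + 1))) ∞ M] [MulAction ℂˣ M]
  {J : EndField (𝓡 (2 * (n + 1))) M} {g : BilinField (𝓡 (2 * (n + 1))) M}
  {nabla : Connection (𝓡 (2 * (n + 1))) M} {ξ : VField (𝓡 (2 * (n + 1))) M}
  {B : Type*} [TopologicalSpace B] [ChartedSpace (EuclideanSpace ℝ (Fin (2 * n))) B]
  [IsManifold (𝓡 (2 * n)) ∞ B] {pr : M → B} {h : RMetric (2 * n) B}

theorem IsProjectiveSpecialKahler.potential_pos
    (hB : IsProjectiveSpecialKahler J g nabla ξ pr h) (hn : n ≠ 0) (x : M) :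
    0 < potential g ξ x := by
  have hξ : ξ x ≠ 0 := fun h0 ↦ by
    have h1 : ∀ v, mfderiv (𝓡 (2 * (n + 1))) (𝓡 (2 * n)) pr x v = 0 := fun v ↦ by
      by_contra hv
      have h2 := h.pos (pr x) _ hv
      rw [hB.pullback] at h2
      simp [horizontalForm, potential, h0] at h2
    let i₀ : Fin (2 * n) := ⟨0, by omega⟩
    obtain ⟨v, hv⟩ := hB.submersion x (EuclideanSpace.single i₀ (1 : ℝ) :)
    have h3 : (EuclideanSpace.single i₀ (1 : ℝ)) = 0 := hv.symm.trans (h1 v)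
    simp at h3
  exact hB.conical.pos x (ξ x) (Submodule.subset_span (mem_insert _ _)) hξ

end Projective

theorem exists_compact_of_orbit {n : ℕ}
    {M : Type*} [TopologicalSpace M] [T2Space M] [SecondCountableTopology M]
    [ChartedSpace (EuclideanSpace ℝ (Fin (2 * (n + 1)))) M]
    [IsManifold (𝓡 (2 * (n + 1))) ∞ M] [MulAction ℂˣ M]
    {J : EndField (𝓡 (2 * (n + 1))) M} {g : BilinField (𝓡 (2 * (n + 1))) M}
    {nabla : Connection (𝓡 (2 * (n + 1))) M} {ξ : VField (𝓡 (2 * (n + 1))) M}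
    {B : Type*} [TopologicalSpace B] [T2Space B]
    [ChartedSpace (EuclideanSpace ℝ (Fin (2 * n))) B] [IsManifold (𝓡 (2 * n)) ∞ B]
    {pr : M → B} {h : RMetric (2 * n) B} (hB : IsProjectiveSpecialKahler J g nabla ξ pr h)
    {N : Type*} [TopologicalSpace N] [ChartedSpace (EuclideanHalfSpace (2 * (n + 1))) N]
    [IsManifold (𝓡∂ (2 * (n + 1))) ∞ N]
    {i : M → N} {J' : EndField (𝓡∂ (2 * (n + 1))) N} {g' : BilinField (𝓡∂ (2 * (n + 1))) N}
    {ξ' : VField (𝓡∂ (2 * (n + 1))) N} (hreg : HasRegularBoundary J g ξ i J' g' ξ') (p : N) :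
    letI : RiemannianBundle (fun x : B ↦ TangentSpace (𝓡 (2 * n)) x) := ⟨h.toRiemannianMetric⟩
    ∃ δ > 0, ∃ V ∈ 𝓝 p, ∀ x, i x ∈ V →
      ∃ K : Set B, IsCompact K ∧ ∀ b, riemannianEDist (𝓡 (2 * n)) (pr x) b < δ → b ∈ K := by
  let : RiemannianBundle (fun x : B ↦ TangentSpace (𝓡 (2 * n)) x) := ⟨h.toRiemannianMetric⟩
  have : IsContinuousRiemannianBundle (EuclideanSpace ℝ (Fin (2 * n)))
      (fun x : B ↦ TangentSpace (𝓡 (2 * n)) x) :=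
    ⟨h.inner, h.contMDiff.continuous, fun _ _ _ ↦ rfl⟩
  obtain rfl | hn := eq_or_ne n 0
  · exact ⟨⊤, ENNReal.zero_lt_top, univ, univ_mem, fun x _ ↦
      ⟨{pr x}, isCompact_singleton, fun b hb ↦ eq_of_riemannianEDist_lt_top rfl hb⟩⟩
  obtain ⟨x₀, rfl⟩ | hp := hreg.mem_range_or_mem_boundary p
  · obtain ⟨δ, hδ, V, hV, hVK⟩ := exists_compact_of_riemannianEDist_lt (k := 2 * n) (pr x₀)
    have h1 := hB.smooth.continuous.continuousAt.preimage_mem_nhds hV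
    rw [hreg.embedding.isEmbedding.isInducing.nhds_eq_comap] at h1
    obtain ⟨W, hW, hWV⟩ := h1
    exact ⟨δ, hδ, W, hW, fun x hx ↦ hVK _ (hWV hx)⟩
  · have : LocallyCompactSpace M :=
      Manifold.locallyCompact_of_finiteDimensional (𝓡 (2 * (n + 1)))
    have hK := hB.conical.pseudoKahler
    obtain ⟨D, hD, hDξ⟩ := hB.conical.leviCivita_field
    refine hreg.exists_compact_of_mem_boundary hK.metric.nondegenerate (hB.potential_pos hn)
      hK.complex.sq hK.metric.symm hK.hermitian
      (mvfderiv_potential hB.conical.smooth_field hK.metric.symm hD.parallel hDξ)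
      (hB.smooth.of_le (by simp)) hB.submersion (fun x v ↦ ?_) hp
    rw [← hB.pullback, ← real_inner_self_eq_norm_sq]
    rfl

end SpecialKahler

end

theorem mainTheorem1 {n : ℕ}
    {M : Type*} [TopologicalSpace M] [T2Space M] [SecondCountableTopology M]
    [ChartedSpace (EuclideanSpace ℝ (Fin (2 * (n + 1)))) M]
    [IsManifold (𝓡 (2 * (n + 1))) ∞ M] [MulAction ℂˣ M]
    (J : SpecialKahler.EndField (𝓡 (2 * (n + 1))) M)
    (g : SpecialKahler.BilinField (𝓡 (2 * (n + 1))) M)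
    (nabla : SpecialKahler.Connection (𝓡 (2 * (n + 1))) M)
    (ξ : SpecialKahler.VField (𝓡 (2 * (n + 1))) M)
    {B : Type*} [TopologicalSpace B] [T2Space B] [SecondCountableTopology B]
    [ChartedSpace (EuclideanSpace ℝ (Fin (2 * n))) B] [IsManifold (𝓡 (2 * n)) ∞ B]
    (pr : M → B) (h : SpecialKahler.RMetric (2 * n) B)
    (hB : SpecialKahler.IsProjectiveSpecialKahler J g nabla ξ pr h)
    {N : Type*} [TopologicalSpace N] [T2Space N] [SecondCountableTopology N]
    [ChartedSpace (EuclideanHalfSpace (2 * (n + 1))) N]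
    [IsManifold (𝓡∂ (2 * (n + 1))) ∞ N] [MulAction ℂˣ N]
    (i : M → N)
    (J' : SpecialKahler.EndField (𝓡∂ (2 * (n + 1))) N)
    (g' : SpecialKahler.BilinField (𝓡∂ (2 * (n + 1))) N)
    (ξ' : SpecialKahler.VField (𝓡∂ (2 * (n + 1))) N)
    (hreg : SpecialKahler.HasRegularBoundary J g ξ i J' g' ξ')
    (hprincipal : SpecialKahler.IsPrincipalAction (𝓡∂ (2 * (n + 1))) N)
    (hgenerates : SpecialKahler.Generates J' ξ')
    (hequivariant : ∀ (a : ℂˣ) (x : M), i (a • x) = a • i x)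
    (hcompact : CompactSpace (MulAction.orbitRel.Quotient ℂˣ N)) :
    SpecialKahler.IsCompleteMetric h := by
  let : RiemannianBundle (fun x : B ↦ TangentSpace (𝓡 (2 * n)) x) := ⟨h.toRiemannianMetric⟩
  have : IsContinuousRiemannianBundle (EuclideanSpace ℝ (Fin (2 * n)))
      (fun x : B ↦ TangentSpace (𝓡 (2 * n)) x) :=
    ⟨h.inner, h.contMDiff.continuous, fun _ _ _ ↦ rfl⟩
  have : LocallyCompactSpace B := Manifold.locallyCompact_of_finiteDimensional (𝓡 (2 * n))
  let : EMetricSpace B := EMetricSpace.ofRiemannianMetric (𝓡 (2 * n)) B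
  have : ContinuousConstSMul ℂˣ N :=
    ⟨fun a ↦ hprincipal.smooth.continuous.comp (Continuous.prodMk_right a)⟩
  let κ : N → MulAction.orbitRel.Quotient ℂˣ N := Quotient.mk _
  choose x hx using hB.surjective
  refine SpecialKahler.completeSpace_of_locally_uniform_compact_balls (fun b ↦ κ (i (x b)))
    fun q ↦ ?_
  obtain ⟨p, rfl⟩ := Quotient.exists_rep q
  obtain ⟨δ, hδ, V, hV, hVK⟩ := SpecialKahler.exists_compact_of_orbit hB hreg p
  have hopen : IsOpenMap κ := isOpenMap_quotient_mk'_mul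
  refine ⟨δ, hδ, κ '' V, hopen.image_mem_nhds hV, ?_⟩
  rintro b ⟨y, hy, hyb⟩
  obtain ⟨a, rfl⟩ : ∃ a : ℂˣ, a • i (x b) = y := Quotient.exact hyb
  rw [← hequivariant] at hy
  obtain ⟨K, hK, hbK⟩ := hVK _ hy
  refine ⟨K, hK, fun b' hb' ↦ hbK b' ?_⟩
  rw [← (hB.fibre (x b) (a • x b)).2 ⟨a, rfl⟩, hx b, riemannianEDist_comm]
  exact hb'
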